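/- For $a\in\mathbb{C}$ let $$L_a=\frac{\partial}{\partial t}+\begin{pmatrix}0&1&0\\1&0&0\\0&0&0\end{pmatrix}\frac{\partial}{\partial x}+x\begin{pmatrix}0&a&1\\-a&0&0\\1+a^2&0&0\end{pmatrix}\frac{\partial}{\partial y},\qquad W_0=\begin{pmatrix}1\\0\\0\end{pmatrix},$$ acting on $\mathbb{C}^3$-valued functions of $(t,x,y)\in\mathbb{R}^3$. Let $\gamma_0^{(2)}(\mathbb{R})$ be the set of those $f\in C_0^\infty(\mathbb{R})$ such that for every compact $K\subset\mathbb{R}$ there are $C,A>0$ with $|f^{(n)}(x)|\le C A^{n}(n!)^2$ for all $x\in K$ and all $n\in\mathbb{N}$. Assume that $ia\notin[-1,1]$. Let $\phi,\psi\in C_0^\infty(\mathbb{R})$ be real valued, with $\psi$ even, $\psi\notin\gamma_0^{(2)}(\mathbb{R})$ and $\phi(0)\neq0$. Let $\Omega\subset\mathbb{R}^3$ be an open neighbourhood of the origin such that $\{(0,x,y):(x,y)\in\operatorname{supp}(\phi(x)\psi(y))\}\subset\Omega$. Then there is no $U\in C^1(\Omega;\mathbb{C}^3)$ such that $L_aU=0$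 in $\Omega$ and $U(0,x,y)=\phi(x)\psi(y)W_0$ for all $(x,y)$ with $(0,x,y)\in\Omega$. -/

import Mathlib

open scoped ContDiff Matrix

noncomputable section

/-- `C_0^∞(ℝ)`: smooth real valued functions on the line with compact support. -/
def IsTestFunction (f : ℝ → ℝ) : Prop :=
  ContDiff ℝ ∞ f ∧ HasCompactSupport f

/-- The Gevrey class `γ^{(s)}(ℝ)`: smooth functions such that on every compact set
`|f^{(n)}(x)| ≤ C A^n (n!)^s` for all `n`, with `C, A > 0` depending on the compact set. -/
def IsGevrey (s : ℝ) (f : ℝ → ℝ) : Prop :=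
  ContDiff ℝ ∞ f ∧
    ∀ K : Set ℝ, IsCompact K → ∃ C > (0 : ℝ), ∃ A > (0 : ℝ), ∀ x ∈ K, ∀ n : ℕ,
      |iteratedDeriv n f x| ≤ C * A ^ n * (n.factorial : ℝ) ^ s

/-- `γ_0^{(s)}(ℝ) = γ^{(s)}(ℝ) ∩ C_0^∞(ℝ)`. -/
def IsGevreyCompact (s : ℝ) (f : ℝ → ℝ) : Prop :=
  IsGevrey s f ∧ IsTestFunction f

/-- The coefficient matrix of `∂/∂x`. -/
def coeffA : Matrix (Fin 3) (Fin 3) ℂ :=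
  !![0, 1, 0;
     1, 0, 0;
     0, 0, 0]

/-- The matrix `B` in the coefficient `x B` of `∂/∂y`. -/
def coeffB (a : ℂ) : Matrix (Fin 3) (Fin 3) ℂ :=
  !![0, a, 1;
     -a, 0, 0;
     1 + a ^ 2, 0, 0]

/-- The vector `W_0`. -/
def vecW0 : Fin 3 → ℂ := ![1, 0, 0]

/-- The operator `L_a U = ∂_t U + A ∂_x U + x B ∂_y U`, applied to a function `U` of `(t, x, y)`
and evaluated at the point `p = (t, x, y)`. -/
def opL (a : ℂ) (U : ℝ × ℝ × ℝ → Fin 3 → ℂ) (p : ℝ × ℝ × ℝ) : Fin 3 → ℂ :=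
  fderiv ℝ U p (1, 0, 0) + coeffA *ᵥ fderiv ℝ U p (0, 1, 0)
    + (p.2.1 : ℂ) • (coeffB a *ᵥ fderiv ℝ U p (0, 0, 1))

/-- `U` is a `C^1` solution, on the open set `Ω` of points `(t, x, y)`, of the Cauchy problem
`L_a U = 0`, `U(0, x, y) = φ(x) ψ(y) W_0`. -/
structure IsC1Solution (a : ℂ) (φ ψ : ℝ → ℝ) (Ω : Set (ℝ × ℝ × ℝ))
    (U : ℝ × ℝ × ℝ → Fin 3 → ℂ) : Prop where
  contDiffOn : ContDiffOn ℝ 1 U Ω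
  equation : ∀ p ∈ Ω, opL a U p = 0
  initial : ∀ x y : ℝ, ((0 : ℝ), x, y) ∈ Ω →
    U (0, x, y) = ((φ x * ψ y : ℝ) : ℂ) • vecW0

end

/-!
Suppose that a `C¹` solution `U` exists. The proof shows that `ψ` is then Gevrey of order two.

The adjoint of `L_a` has, for real `ξ > 0`, the exact solutions
`e^{iξy - ξx²/2 - μt} (1, μx, iξx/μ)` with `μ² = -(1 - ia)ξ`. They are the ground states of the
harmonic oscillator which governs the first component. Unless `ia` is a real number `≤ 1`, a root
`κ` of `κ² = -(1 - ia)` has `Re κ > 0`, so `μ = κ√ξ` gives modes which decay like `e^{-c√ξ t}`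
forwards in time: pairing with `U` shows that the initial value of `U` has a component of
size `e^{-c√ξ}` along the mode (`integral_halfSpace_opL_mode`). If `ia < -1`, complex conjugation
of `U` reduces to `ia > 1` (`IsC1Solution.conj`). The hypothesis excludes the remaining `ia`.

As `U` lives only near `{0} × {0} × supp ψ`, it has to be cut off
(`IsC1Solution.exists_localization`), and `L_a` of the cut-off function must be negligible against
the test functions. At times bounded below, the decay of the mode takes care of that, and away from
`x = 0` the Gaussian in `x` does. Away from `supp ψ` a single mode is not small. Therefore modes with
`ξ = l²ρ²`, `1/2 ≤ ρ ≤ 3/2`, are superposed with the weight `e^{-l²(ρ² - 1)²/2}` into a wave packet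
based at a point `y₀` near `supp ψ`. It is an exact solution of the adjoint system, and shifting the
contour of integration in `ρ` shows that it is exponentially small away from `y = y₀`
(`exists_norm_packet_le`). This replaces a uniqueness theorem for `L_a`. The modes are divided by
the Gaussian moments of the profile in `x`, which do not vanish for large `l` as `φ(0) ≠ 0`
(`exists_le_norm_gaussianMoment`).

The outcome is that the Gaussian wave packet transform of `ψ` at frequency `l²` is `O(e^{-cl})` at all
base points near `supp ψ`. Integrating over the base points gives `O(e^{-c√ξ})` for the Fourier
transform of `ψ` (`fourier_decay_of_gaussian_transform_decay`), which is Gevrey regularity of order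
two (`isGevrey_two_of_fourier_decay`).
-/

open scoped ContDiff Matrix
open MeasureTheory Complex FourierTransform

/-! ### Gevrey regularity from decay of the Fourier transform -/

theorem integrable_exp_neg_mul_sqrt_abs {c : ℝ} (hc : 0 < c) :
    Integrable fun x : ℝ => Real.exp (-(c * √|x|)) := by
  have hm : 0 < min 1 (c ^ 4 / 24) := by positivity
  refine (integrable_inv_one_add_sq.const_mul (min 1 (c ^ 4 / 24))⁻¹).mono'
    (by fun_prop) (.of_forall fun x => ?_)
  rw [Real.norm_eq_abs, Real.abs_exp, Real.exp_neg, ← mul_inv]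
  apply inv_anti₀ (by positivity)
  have h0 : 0 ≤ c * √|x| := by positivity
  have h4 : (c * √|x|) ^ 4 = c ^ 4 * x ^ 2 := by
    rw [mul_pow, show √|x| ^ 4 = (√|x| ^ 2) ^ 2 by ring, Real.sq_sqrt (abs_nonneg x), sq_abs]
  have h := Real.sum_le_exp_of_nonneg h0 5
  simp only [Finset.sum_range_succ, Finset.range_zero, Finset.sum_empty, Nat.factorial] at h
  have : (c * √|x|) ^ 4 / 24 = c ^ 4 / 24 * x ^ 2 := by rw [h4]; ring
  have h2 : 1 + c ^ 4 / 24 * x ^ 2 ≤ Real.exp (c * √|x|) := by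
    refine le_trans ?_ h
    rw [← this]
    norm_num
    nlinarith [pow_nonneg h0 2, pow_nonneg h0 3]
  refine le_trans ?_ h2
  nlinarith [min_le_left 1 (c ^ 4 / 24), min_le_right 1 (c ^ 4 / 24), sq_nonneg x]

theorem factorial_two_mul_le (n : ℕ) :
    ((2 * n).factorial : ℝ) ≤ 4 ^ n * (n.factorial : ℝ) ^ 2 := by
  have h := Nat.choose_mul_factorial_mul_factorial (show n ≤ 2 * n by omega)
  rw [show 2 * n - n = n by omega] at h
  have h2 := Nat.choose_le_two_pow (2 * n) n
  rw [pow_mul] at h2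
  norm_num at h2
  have : (2 * n).factorial ≤ 4 ^ n * n.factorial ^ 2 := by
    rw [← h, mul_assoc, ← sq]
    gcongr
  exact_mod_cast this

theorem abs_pow_mul_exp_neg_sqrt_le {c : ℝ} (hc : 0 < c) (n : ℕ) (x : ℝ) :
    |x| ^ n * Real.exp (-(c * √|x|)) ≤
      (16 / c ^ 2) ^ n * (n.factorial : ℝ) ^ 2 * Real.exp (-(c / 2 * √|x|)) := by
  have h := Real.pow_div_factorial_le_exp (c / 2 * √|x|) (by positivity) (2 * n)
  rw [div_le_iff₀ (by positivity), pow_mul, mul_pow, Real.sq_sqrt (abs_nonneg x), mul_pow] at h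
  have hx : |x| ^ n ≤
      (4 / c ^ 2) ^ n * (Real.exp (c / 2 * √|x|) * (2 * n).factorial) := by
    calc |x| ^ n = (4 / c ^ 2) ^ n * (((c / 2) ^ 2) ^ n * |x| ^ n) := by
          rw [← mul_assoc, ← mul_pow]
          have : 4 / c ^ 2 * (c / 2) ^ 2 = 1 := by field_simp; norm_num
          rw [this, one_pow, one_mul]
      _ ≤ _ := by gcongr
  calc |x| ^ n * Real.exp (-(c * √|x|))
      ≤ (4 / c ^ 2) ^ n * (Real.exp (c / 2 * √|x|) * (4 ^ n * (n.factorial : ℝ) ^ 2)) *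
          Real.exp (-(c * √|x|)) := by
        gcongr
        exact hx.trans (by gcongr; exact factorial_two_mul_le n)
    _ = (4 / c ^ 2 * 4) ^ n * (n.factorial : ℝ) ^ 2 *
          (Real.exp (c / 2 * √|x|) * Real.exp (-(c * √|x|))) := by rw [mul_pow]; ring
    _ = _ := by
        rw [← Real.exp_add]; congr 2
        · ring
        · ring

/-- If `∫ ψ(y) e^{iξy} dy` is `O(e^{-c√ξ})` as `ξ → +∞`, then `ψ` is in the Gevrey class of order
two. Negative frequencies need no hypothesis, `ψ` being real valued. -/
theorem isGevrey_two_of_fourier_decay {ψ : ℝ → ℝ} (hψ : IsTestFunction ψ) {C c R : ℝ}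
    (hc : 0 < c) (hdecay : ∀ ξ : ℝ, R ≤ ξ →
      ‖∫ y : ℝ, (ψ y : ℂ) * cexp (I * ξ * y)‖ ≤ C * Real.exp (-(c * √ξ))) :
    IsGevrey 2 ψ := by
  obtain ⟨hsmooth, hcomp⟩ := hψ
  have hcont : Continuous fun y : ℝ => (ψ y : ℂ) := by
    have := hsmooth.continuous; fun_prop
  have hcompC : HasCompactSupport fun y : ℝ => (ψ y : ℂ) :=
    hcomp.comp_left (g := fun r : ℝ => (r : ℂ)) (by simp)
  have hint : Integrable fun y : ℝ => (ψ y : ℂ) := hcont.integrable_of_hasCompactSupport hcompC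
  set g : ℝ → ℂ := 𝓕⁻ fun y : ℝ => (ψ y : ℂ) with hg
  have hgval (w : ℝ) : g w = ∫ y : ℝ, (ψ y : ℂ) * cexp (I * ((2 * Real.pi * w : ℝ) : ℂ) * y) := by
    rw [hg, Real.fourierInv_eq']
    congr 1; ext y
    rw [smul_eq_mul, mul_comm]
    congr 2
    simp only [RCLike.inner_apply, conj_trivial]
    push_cast; ring
  have hgneg (w : ℝ) : g (-w) = starRingEnd ℂ (g w) := by
    rw [hgval, hgval, ← integral_conj]
    congr 1; ext y
    rw [map_mul, conj_ofReal, ← Complex.exp_conj]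
    congr 2
    simp [Complex.conj_ofNat]
  set M := ∫ y : ℝ, ‖(ψ y : ℂ)‖ with hM
  have hM0 : 0 ≤ M := integral_nonneg fun _ => norm_nonneg _
  have hgM (w : ℝ) : ‖g w‖ ≤ M := by
    rw [hgval]
    refine (norm_integral_le_integral_norm _).trans (le_of_eq ?_)
    congr 1; ext y
    rw [norm_mul, show I * ((2 * Real.pi * w : ℝ) : ℂ) * y =
      ((2 * Real.pi * w * y : ℝ) : ℂ) * I by push_cast; ring, norm_exp_ofReal_mul_I, mul_one]
  -- The constants absorb the bounded range of frequencies where the hypothesis is silent.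
  set D := |C| + M * Real.exp (c * √|R|) with hD
  have hD0 : 0 ≤ D := by positivity
  have hpos (w : ℝ) (hw : 0 ≤ w) : ‖g w‖ ≤ D * Real.exp (-(c * √|w|)) := by
    have hw2 : w ≤ 2 * Real.pi * w := by nlinarith [Real.pi_gt_three]
    rcases le_total R (2 * Real.pi * w) with h | h
    · rw [hgval]
      refine (hdecay _ h).trans ?_
      rw [abs_of_nonneg hw]
      gcongr
      exact (le_abs_self C).trans (by rw [hD]; exact le_add_of_nonneg_right (by positivity))
    · have hwR : |w| ≤ |R| := by
        rw [abs_of_nonneg hw]; exact (hw2.trans h).trans (le_abs_self R)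
      calc ‖g w‖ ≤ M := hgM w
        _ = M * Real.exp (c * √|R|) * Real.exp (-(c * √|R|)) := by
          rw [mul_assoc, ← Real.exp_add]; simp
        _ ≤ D * Real.exp (-(c * √|w|)) := by
          gcongr
          rw [hD]; exact le_add_of_nonneg_left (abs_nonneg C)
  have hall (w : ℝ) : ‖g w‖ ≤ D * Real.exp (-(c * √|w|)) := by
    rcases le_total 0 w with h | h
    · exact hpos w h
    · have := hpos (-w) (by linarith)
      rwa [hgneg, abs_neg, RCLike.norm_conj] at this
  have hgcont : Continuous g := by
    have : g = fun w => (𝓕 fun y : ℝ => (ψ y : ℂ)) (-w) := by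
      ext w; rw [hg, Real.fourierInv_eq_fourier_neg]
    rw [this]
    exact (VectorFourier.fourierIntegral_continuous Real.continuous_fourierChar
      (by exact continuous_inner) hint).comp continuous_neg
  have hbound (n : ℕ) (x : ℝ) : |x| ^ n * ‖g x‖ ≤
      D * ((16 / c ^ 2) ^ n * (n.factorial : ℝ) ^ 2) * Real.exp (-(c / 2 * √|x|)) := by
    calc |x| ^ n * ‖g x‖ ≤ |x| ^ n * (D * Real.exp (-(c * √|x|))) := by gcongr; exact hall x
      _ = D * (|x| ^ n * Real.exp (-(c * √|x|))) := by ring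
      _ ≤ D * ((16 / c ^ 2) ^ n * (n.factorial : ℝ) ^ 2 * Real.exp (-(c / 2 * √|x|))) := by
        exact mul_le_mul_of_nonneg_left (abs_pow_mul_exp_neg_sqrt_le hc n x) hD0
      _ = _ := by ring
  have hgint (n : ℕ) : Integrable fun x : ℝ => x ^ n • g x := by
    refine ((integrable_exp_neg_mul_sqrt_abs (half_pos hc)).const_mul
      (D * ((16 / c ^ 2) ^ n * (n.factorial : ℝ) ^ 2))).mono' (by fun_prop) (.of_forall fun x => ?_)
    rw [norm_smul, norm_pow, Real.norm_eq_abs]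
    exact hbound n x
  have hFint : Integrable (𝓕 fun y : ℝ => (ψ y : ℂ)) := by
    have h1 : Integrable g := by simpa using hgint 0
    have : (𝓕 fun y : ℝ => (ψ y : ℂ)) = fun w => g (-w) := by
      ext w; rw [hg, Real.fourierInv_eq_fourier_neg, neg_neg]
    rw [this]
    exact h1.comp_neg
  have hinv : 𝓕 g = fun y : ℝ => (ψ y : ℂ) := hcont.fourier_fourierInv_eq hint hFint
  set N := ∫ x : ℝ, Real.exp (-(c / 2 * √|x|)) with hN
  have hN0 : 0 ≤ N := integral_nonneg fun _ => (Real.exp_pos _).le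
  refine ⟨hsmooth, fun K _ => ⟨D * N + 1, by positivity, 2 * Real.pi * (16 / c ^ 2),
    by positivity, fun x _ n => ?_⟩⟩
  have h1 : |iteratedDeriv n ψ x| = ‖iteratedDeriv n (fun y : ℝ => (ψ y : ℂ)) x‖ := by
    rw [← Real.norm_eq_abs, ← norm_iteratedFDeriv_eq_norm_iteratedDeriv,
      ← norm_iteratedFDeriv_eq_norm_iteratedDeriv]
    exact (ofRealLI.norm_iteratedFDeriv_comp_left (hsmooth.contDiffAt)
      (by exact_mod_cast le_top)).symm
  rw [h1, ← hinv, Real.iteratedDeriv_fourier (N := ⊤) (fun n _ => hgint n) le_top]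
  refine (VectorFourier.norm_fourierIntegral_le_integral_norm _ _ _ _ _).trans ?_
  calc ∫ v : ℝ, ‖(-2 * Real.pi * I * v) ^ n • g v‖
      ≤ ∫ v : ℝ, (2 * Real.pi) ^ n * (D * ((16 / c ^ 2) ^ n * (n.factorial : ℝ) ^ 2)) *
          Real.exp (-(c / 2 * √|v|)) := by
        refine integral_mono_of_nonneg (.of_forall fun _ => norm_nonneg _)
          ((integrable_exp_neg_mul_sqrt_abs (half_pos hc)).const_mul _) (.of_forall fun v => ?_)
        have : ‖(-2 * Real.pi * I * v : ℂ) ^ n • g v‖ = (2 * Real.pi) ^ n * (|v| ^ n * ‖g v‖) := by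
          rw [norm_smul, norm_pow]
          simp [abs_of_pos Real.pi_pos, mul_pow, mul_assoc]
        simp only [this]
        calc _ ≤ (2 * Real.pi) ^ n * (D * ((16 / c ^ 2) ^ n * (n.factorial : ℝ) ^ 2) *
              Real.exp (-(c / 2 * √|v|))) :=
              mul_le_mul_of_nonneg_left (hbound n v) (by positivity)
          _ = _ := by ring
    _ = D * N * (2 * Real.pi * (16 / c ^ 2)) ^ n * (n.factorial : ℝ) ^ 2 := by
        rw [integral_const_mul, mul_pow (2 * Real.pi)]; ring
    _ ≤ (D * N + 1) * (2 * Real.pi * (16 / c ^ 2)) ^ n * (n.factorial : ℝ) ^ (2 : ℝ) := by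
        rw [Real.rpow_two]
        gcongr
        linarith

/-! ### From truncated wave packets to the Fourier transform -/

theorem integral_cexp_wavePacket {l : ℝ} (hl : 0 < l) (s : ℝ) :
    ∫ z : ℝ, cexp (-(l ^ 2 * z ^ 2 / 2) + I * l ^ 2 * (1 + z) * s) =
      (√(2 * Real.pi) / l : ℝ) * (cexp (I * l ^ 2 * s) * cexp (-(l ^ 2 * s ^ 2 / 2))) := by
  have hb : (((-(l ^ 2 / 2) : ℝ)) : ℂ).re < 0 := by
    rw [ofReal_re]; have := pow_pos hl 2; linarith
  have hl' : (l : ℂ) ≠ 0 := by exact_mod_cast hl.ne'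
  have h := integral_cexp_quadratic hb (I * l ^ 2 * s) (I * l ^ 2 * s)
  have e1 : ∀ z : ℝ, cexp (-(l ^ 2 * z ^ 2 / 2) + I * l ^ 2 * (1 + z) * s) =
      cexp ((((-(l ^ 2 / 2) : ℝ)) : ℂ) * z ^ 2 + (I * l ^ 2 * s) * z + I * l ^ 2 * s) := by
    intro z; congr 1; push_cast; ring
  simp_rw [e1]
  rw [h, ← Complex.exp_add]
  congr 1
  · rw [show (Real.pi : ℂ) / -(((-(l ^ 2 / 2) : ℝ)) : ℂ) = ((2 * Real.pi / l ^ 2 : ℝ) : ℂ) by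
      push_cast; field_simp,
      show (1 / 2 : ℂ) = ((1 / 2 : ℝ) : ℂ) by push_cast; rfl,
      ← ofReal_cpow (by positivity), ← Real.sqrt_eq_rpow, Real.sqrt_div (by positivity),
      Real.sqrt_sq hl.le]
  · congr 1
    push_cast
    field_simp
    ring_nf
    simp only [I_sq]
    ring

theorem norm_cexp_wavePacket (l s z : ℝ) :
    ‖cexp (-(l ^ 2 * z ^ 2 / 2) + I * l ^ 2 * (1 + z) * s)‖ = Real.exp (-(l ^ 2 * z ^ 2 / 2)) := by
  rw [show (-(l ^ 2 * z ^ 2 / 2) + I * l ^ 2 * (1 + z) * s : ℂ) =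
    ((-(l ^ 2 * z ^ 2 / 2) : ℝ) : ℂ) + ((l ^ 2 * (1 + z) * s : ℝ) : ℂ) * I by push_cast; ring,
    norm_exp]
  simp only [add_re, ofReal_re, re_ofReal_mul, I_re, mul_zero, add_zero]

/-- A superposition of the frequencies `l²ρ²`, `ρ ∈ [1/2, 3/2]`, with a Gaussian weight is a
Gaussian wave packet of frequency `l²`, up to an exponentially small truncation error. -/
theorem norm_truncated_wavePacket_sub_le {l : ℝ} (hl : 1 ≤ l) (s : ℝ) :
    ‖(∫ ρ in (1 / 2 : ℝ)..(3 / 2), (ρ : ℂ) *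
        cexp (-(l ^ 2 * (ρ ^ 2 - 1) ^ 2 / 2) + I * l ^ 2 * ρ ^ 2 * s)) -
      (√(2 * Real.pi) / l / 2 : ℝ) * (cexp (I * l ^ 2 * s) * cexp (-(l ^ 2 * s ^ 2 / 2)))‖ ≤
      √(4 * Real.pi) * Real.exp (-(l / 8)) := by
  have hl0 : 0 < l := by linarith
  set f : ℝ → ℂ := fun z => cexp (-(l ^ 2 * z ^ 2 / 2) + I * l ^ 2 * (1 + z) * s) with hf
  have hfc : Continuous f := by fun_prop
  have hgauss : Integrable fun z : ℝ => Real.exp (-(1 / 4) * z ^ 2) :=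
    integrable_exp_neg_mul_sq (by norm_num)
  have hfi : Integrable f := by
    refine hgauss.mono' hfc.aestronglyMeasurable (.of_forall fun z => ?_)
    rw [hf]; simp only
    rw [norm_cexp_wavePacket]
    apply Real.exp_le_exp.2
    nlinarith [sq_nonneg z, mul_nonneg (sq_nonneg z) (by nlinarith : (0 : ℝ) ≤ l ^ 2 - 1)]
  have h1 : (∫ ρ in (1 / 2 : ℝ)..(3 / 2), (ρ : ℂ) *
        cexp (-(l ^ 2 * (ρ ^ 2 - 1) ^ 2 / 2) + I * l ^ 2 * ρ ^ 2 * s)) =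
      (1 / 2 : ℂ) * ∫ z in (-(3 / 4) : ℝ)..(5 / 4), f z := by
    have := intervalIntegral.integral_deriv_smul_comp (a := 1 / 2) (b := 3 / 2)
      (f := fun ρ : ℝ => ρ ^ 2 - 1) (f' := fun ρ => 2 * ρ) (g := f)
      (fun x _ => by simpa using (hasDerivAt_pow 2 x).sub_const 1) (by fun_prop) hfc
    norm_num at this
    norm_num
    rw [← this, ← intervalIntegral.integral_const_mul]
    congr 1; ext ρ
    simp only [hf]
    push_cast
    rw [show (1 + ((ρ : ℂ) ^ 2 - 1)) = (ρ : ℂ) ^ 2 by ring]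
    ring
  rw [h1, intervalIntegral.integral_of_le (by norm_num)]
  have h2 := integral_add_compl (μ := volume) (f := f)
    (measurableSet_Ioc (a := (-(3 / 4) : ℝ)) (b := 5 / 4)) hfi
  rw [hf] at h2
  simp only at h2
  rw [integral_cexp_wavePacket hl0] at h2
  have h3 : (√(2 * Real.pi) / l / 2 : ℝ) * (cexp (I * l ^ 2 * s) * cexp (-(l ^ 2 * s ^ 2 / 2))) =
      (1 / 2 : ℂ) * ((√(2 * Real.pi) / l : ℝ) *
        (cexp (I * l ^ 2 * s) * cexp (-(l ^ 2 * s ^ 2 / 2)))) := by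
    push_cast; ring
  rw [h3, ← h2, ← mul_sub, sub_add_cancel_left, norm_mul, norm_neg]
  have h4 : ‖∫ z in (Set.Ioc (-(3 / 4) : ℝ) (5 / 4))ᶜ, f z‖ ≤
      √(4 * Real.pi) * Real.exp (-(l / 8)) := by
    calc _ ≤ ∫ z in (Set.Ioc (-(3 / 4) : ℝ) (5 / 4))ᶜ,
          Real.exp (-(l / 8)) * Real.exp (-(1 / 4) * z ^ 2) := by
          refine norm_integral_le_of_norm_le (hgauss.const_mul _).integrableOn ?_
          refine (ae_restrict_iff' measurableSet_Ioc.compl).2 (.of_forall fun z hz => ?_)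
          rw [hf]; simp only
          rw [norm_cexp_wavePacket, ← Real.exp_add]
          apply Real.exp_le_exp.2
          have hz2 : 9 / 16 ≤ z ^ 2 := by
            rw [Set.mem_compl_iff, Set.mem_Ioc, not_and_or, not_lt, not_le] at hz
            rcases hz with h | h <;> nlinarith
          nlinarith [mul_nonneg (sub_nonneg.2 hz2) (by nlinarith : (0 : ℝ) ≤ l ^ 2 - 1)]
      _ ≤ ∫ z : ℝ, Real.exp (-(l / 8)) * Real.exp (-(1 / 4) * z ^ 2) :=
          setIntegral_le_integral (hgauss.const_mul _) (.of_forall fun z => by positivity)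
      _ = _ := by
          rw [integral_const_mul, integral_gaussian, mul_comm]
          congr 2; ring
  have : ‖(1 / 2 : ℂ)‖ ≤ 1 := by norm_num
  calc _ ≤ 1 * ‖∫ z in (Set.Ioc (-(3 / 4) : ℝ) (5 / 4))ᶜ, f z‖ := by gcongr
    _ ≤ _ := by rw [one_mul]; exact h4

/-- A bound for the superposition over `ρ ∈ [1/2, 3/2]` of the Fourier modes of `ψ` of frequency
`l²ρ²` bounds the Gaussian wave packet transform of `ψ` at frequency `l²` and base point `y₀`. -/
theorem norm_gaussian_transform_le {ψ : ℝ → ℝ} (hψ : Continuous ψ) (hc : HasCompactSupport ψ)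
    {l : ℝ} (hl : 1 ≤ l) (y₀ : ℝ) {B : ℝ}
    (h : ‖∫ ρ in (1 / 2 : ℝ)..(3 / 2), (ρ : ℂ) * cexp (-(l ^ 2 * (ρ ^ 2 - 1) ^ 2 / 2)) *
      ∫ y : ℝ, (ψ y : ℂ) * cexp (I * l ^ 2 * ρ ^ 2 * (y - y₀))‖ ≤ B) :
    ‖∫ y : ℝ, ((ψ y : ℂ) * cexp (I * l ^ 2 * y)) * cexp (-(l ^ 2 * (y₀ - y) ^ 2 / 2))‖ ≤
      l * (B + (∫ y : ℝ, ‖ψ y‖) * (√(4 * Real.pi) * Real.exp (-(l / 8)))) := by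
  have hl0 : 0 < l := by linarith
  have hψi : Integrable ψ := hψ.integrable_of_hasCompactSupport hc
  set w : ℝ → ℝ → ℂ := fun ρ y => (ρ : ℂ) *
    cexp (-(l ^ 2 * (ρ ^ 2 - 1) ^ 2 / 2) + I * l ^ 2 * ρ ^ 2 * ((y - y₀ : ℝ) : ℂ)) with hw
  have hwn (ρ y : ℝ) : ‖w ρ y‖ ≤ |ρ| := by
    rw [hw]; simp only
    rw [norm_mul, norm_real, Real.norm_eq_abs,
      show (-(l ^ 2 * (ρ ^ 2 - 1) ^ 2 / 2) + I * l ^ 2 * ρ ^ 2 * ((y - y₀ : ℝ) : ℂ) : ℂ) =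
      ((-(l ^ 2 * (ρ ^ 2 - 1) ^ 2 / 2) : ℝ) : ℂ) + ((l ^ 2 * ρ ^ 2 * (y - y₀) : ℝ) : ℂ) * I by
      push_cast; ring, norm_exp]
    refine mul_le_of_le_one_right (abs_nonneg _) (Real.exp_le_one_iff.2 ?_)
    simp only [add_re, ofReal_re, re_ofReal_mul, I_re, mul_zero, add_zero]
    have := mul_nonneg (sq_nonneg l) (sq_nonneg (ρ ^ 2 - 1))
    linarith
  have h1 : (∫ ρ in (1 / 2 : ℝ)..(3 / 2), (ρ : ℂ) * cexp (-(l ^ 2 * (ρ ^ 2 - 1) ^ 2 / 2)) *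
      ∫ y : ℝ, (ψ y : ℂ) * cexp (I * l ^ 2 * ρ ^ 2 * (y - y₀))) =
      ∫ y : ℝ, ∫ ρ in (1 / 2 : ℝ)..(3 / 2), (ψ y : ℂ) * w ρ y := by
    rw [← intervalIntegral_integral_swap]
    · congr 1; ext ρ
      rw [← integral_const_mul]
      congr 1; ext y
      rw [hw]; simp only
      rw [Complex.exp_add]; push_cast; ring
    · have hb : Integrable (fun ρ : ℝ => |ρ|)
          (volume.restrict (Set.uIoc (1 / 2 : ℝ) (3 / 2))) := by
        rw [Set.uIoc_of_le (by norm_num)]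
        exact (continuous_abs.integrableOn_Icc).mono_set Set.Ioc_subset_Icc_self
      refine (hb.mul_prod hψi.norm).mono' ?_ (.of_forall fun p => ?_)
      · apply Continuous.aestronglyMeasurable
        simp only [hw, Function.uncurry_def]
        fun_prop
      · simp only [Function.uncurry_def]
        rw [norm_mul, norm_real, mul_comm]
        gcongr
        exact hwn _ _
  rw [h1] at h
  set A : ℂ := ((√(2 * Real.pi) / l / 2 : ℝ) : ℂ) with hA
  have hkey : A * cexp (-(I * l ^ 2 * y₀)) *
      (∫ y : ℝ, ((ψ y : ℂ) * cexp (I * l ^ 2 * y)) * cexp (-(l ^ 2 * (y₀ - y) ^ 2 / 2))) =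
      (∫ y : ℝ, ∫ ρ in (1 / 2 : ℝ)..(3 / 2), (ψ y : ℂ) * w ρ y) -
      ∫ y : ℝ, (ψ y : ℂ) * ((∫ ρ in (1 / 2 : ℝ)..(3 / 2), w ρ y) -
        A * (cexp (I * l ^ 2 * ((y - y₀ : ℝ) : ℂ)) *
          cexp (-(l ^ 2 * ((y - y₀ : ℝ) : ℂ) ^ 2 / 2)))) := by
    have i1 : Integrable fun y : ℝ => (ψ y : ℂ) * ∫ ρ in (1 / 2 : ℝ)..(3 / 2), w ρ y := by
      apply Continuous.integrable_of_hasCompactSupport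
      · refine (by fun_prop : Continuous fun y : ℝ => (ψ y : ℂ)).mul ?_
        apply intervalIntegral.continuous_parametric_intervalIntegral_of_continuous'
        simp only [hw, Function.uncurry_def]
        fun_prop
      · exact (hc.comp_left (g := fun r : ℝ => (r : ℂ)) (by simp)).mul_right
    have i2 : Integrable fun y : ℝ => (ψ y : ℂ) * (A *
        (cexp (I * l ^ 2 * ((y - y₀ : ℝ) : ℂ)) *
          cexp (-(l ^ 2 * ((y - y₀ : ℝ) : ℂ) ^ 2 / 2)))) := by
      apply Continuous.integrable_of_hasCompactSupport
      · fun_prop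
      · exact (hc.comp_left (g := fun r : ℝ => (r : ℂ)) (by simp)).mul_right
    simp_rw [mul_sub, intervalIntegral.integral_const_mul]
    rw [integral_sub i1 i2, sub_sub_cancel, ← integral_const_mul]
    congr 1; ext y
    rw [show (I * l ^ 2 * ((y - y₀ : ℝ) : ℂ) : ℂ) = -(I * l ^ 2 * y₀) + I * l ^ 2 * y by
      push_cast; ring, Complex.exp_add,
      show ((y - y₀ : ℝ) : ℂ) ^ 2 = ((y₀ : ℂ) - y) ^ 2 by push_cast; ring]
    ring
  have hbound : ‖A * cexp (-(I * l ^ 2 * y₀)) *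
      (∫ y : ℝ, ((ψ y : ℂ) * cexp (I * l ^ 2 * y)) * cexp (-(l ^ 2 * (y₀ - y) ^ 2 / 2)))‖ ≤
      B + (∫ y : ℝ, ‖ψ y‖) * (√(4 * Real.pi) * Real.exp (-(l / 8))) := by
    rw [hkey]
    refine (norm_sub_le _ _).trans (add_le_add h ?_)
    rw [← integral_mul_const]
    refine norm_integral_le_of_norm_le (hψi.norm.mul_const _) (.of_forall fun y => ?_)
    rw [norm_mul, norm_real]
    gcongr
    exact norm_truncated_wavePacket_sub_le hl (y - y₀)
  have hA1 : 1 ≤ l * ‖A‖ := by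
    rw [hA, norm_real, Real.norm_of_nonneg (by positivity)]
    have : l * (√(2 * Real.pi) / l / 2) = √(2 * Real.pi) / 2 := by field_simp
    rw [this]
    have : 2 ≤ √(2 * Real.pi) := Real.le_sqrt_of_sq_le (by nlinarith [Real.pi_gt_three])
    linarith
  have hu : ‖cexp (-(I * l ^ 2 * y₀))‖ = 1 := by
    rw [show (-(I * l ^ 2 * y₀) : ℂ) = ((-(l ^ 2 * y₀) : ℝ) : ℂ) * I by push_cast; ring,
      norm_exp_ofReal_mul_I]
  rw [norm_mul, norm_mul, hu, mul_one] at hbound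
  refine le_trans ?_ (mul_le_mul_of_nonneg_left hbound hl0.le)
  rw [← mul_assoc]
  exact le_mul_of_one_le_left (norm_nonneg _) hA1

theorem pow_mul_exp_neg_le {c l : ℝ} (hc : 0 < c) (hl : 0 ≤ l) (n : ℕ) :
    l ^ n * Real.exp (-(c * l)) ≤ n.factorial * (2 / c) ^ n * Real.exp (-(c / 2 * l)) := by
  have h := Real.pow_div_factorial_le_exp (c / 2 * l) (by positivity) n
  rw [div_le_iff₀ (by positivity)] at h
  have h2 : l ^ n ≤ (2 / c) ^ n * (Real.exp (c / 2 * l) * n.factorial) := by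
    calc l ^ n = (2 / c) ^ n * (c / 2 * l) ^ n := by
          rw [← mul_pow]; congr 1; field_simp
      _ ≤ _ := by gcongr
  calc _ ≤ (2 / c) ^ n * (Real.exp (c / 2 * l) * n.factorial) * Real.exp (-(c * l)) := by gcongr
    _ = n.factorial * (2 / c) ^ n * (Real.exp (c / 2 * l) * Real.exp (-(c * l))) := by ring
    _ = _ := by rw [← Real.exp_add]; congr 2; ring

/-- Decay of the Gaussian wave packet transform of `ψ` at the points near the support of `ψ`
implies decay of the Fourier transform of `ψ`: away from the support the wave packet transform
is always exponentially small, and its integral over all base points is the Fourier transform. -/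
theorem fourier_decay_of_gaussian_transform_decay {ψ : ℝ → ℝ} (hψ : Continuous ψ)
    (hcs : HasCompactSupport ψ) {d C c R : ℝ} (hd : 0 < d) (hc : 0 < c)
    (h : ∀ l : ℝ, R ≤ l → ∀ y₀ ∈ Metric.cthickening d (tsupport ψ),
      ‖∫ y : ℝ, ((ψ y : ℂ) * cexp (I * l ^ 2 * y)) * cexp (-(l ^ 2 * (y₀ - y) ^ 2 / 2))‖ ≤
        C * Real.exp (-(c * l))) :
    ∃ C' c' R' : ℝ, 0 < c' ∧ ∀ ξ : ℝ, R' ≤ ξ →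
      ‖∫ y : ℝ, (ψ y : ℂ) * cexp (I * ξ * y)‖ ≤ C' * Real.exp (-(c' * √ξ)) := by
  have hψi : Integrable ψ := hψ.integrable_of_hasCompactSupport hcs
  set K := Metric.cthickening d (tsupport ψ) with hK
  have hKc : IsCompact K := IsCompact.cthickening hcs
  set M := ∫ y : ℝ, ‖ψ y‖ with hM
  have hM0 : 0 ≤ M := integral_nonneg fun _ => norm_nonneg _
  set V := volume.real K with hV
  set c₁ := min c (d ^ 2 / 4) with hc₁
  have hc₁0 : 0 < c₁ := by positivity
  set D := V * |C| + M * √(4 * Real.pi) with hD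
  have hD0 : 0 ≤ D := by positivity
  refine ⟨D * (2 / c₁), c₁ / 2, max 1 (|R| ^ 2), by positivity, fun ξ hξ => ?_⟩
  have hξ1 : 1 ≤ ξ := (le_max_left _ _).trans hξ
  set l := √ξ with hl
  have hl2 : l ^ 2 = ξ := Real.sq_sqrt (by linarith)
  have hl1 : 1 ≤ l := Real.one_le_sqrt.2 hξ1
  have hl0 : 0 < l := by linarith
  have hRl : R ≤ l := (le_abs_self R).trans (Real.le_sqrt_of_sq_le ((le_max_right _ _).trans hξ))
  set f : ℝ → ℂ := fun y => (ψ y : ℂ) * cexp (I * l ^ 2 * y) with hf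
  have hfn (y : ℝ) : ‖f y‖ = ‖ψ y‖ := by
    rw [hf]; simp only
    rw [norm_mul, norm_real, show (I * l ^ 2 * y : ℂ) = ((l ^ 2 * y : ℝ) : ℂ) * I by
      push_cast; ring, norm_exp_ofReal_mul_I, mul_one]
  have hfi : Integrable f := by
    refine hψi.norm.mono' ?_ (.of_forall fun y => (hfn y).le)
    exact Continuous.aestronglyMeasurable (by fun_prop)
  set g : ℝ → ℂ := fun s => cexp (-((l ^ 2 / 2 : ℝ) : ℂ) * s ^ 2) with hg
  have hgi : Integrable g := integrable_cexp_neg_mul_sq (by rw [ofReal_re]; positivity)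
  have hgn (s : ℝ) : ‖g s‖ = Real.exp (-(l ^ 2 / 2) * s ^ 2) := by
    rw [hg]; simp only
    rw [norm_exp]; congr 1
    rw [show (-((l ^ 2 / 2 : ℝ) : ℂ) * (s : ℂ) ^ 2) = ((-(l ^ 2 / 2) * s ^ 2 : ℝ) : ℂ) by
      push_cast; ring, ofReal_re]
  have hconv := integral_convolution (μ := volume) (ν := volume)
    (ContinuousLinearMap.mul ℝ ℂ) hfi hgi
  have hgint : 1 ≤ l * ‖∫ s, g s‖ := by
    have : (∫ s, g s) = ((∫ s : ℝ, Real.exp (-(l ^ 2 / 2) * s ^ 2) : ℝ) : ℂ) := by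
      rw [← integral_complex_ofReal]
      congr 1; ext s; rw [hg]; push_cast; rfl
    rw [this, integral_gaussian, norm_real, Real.norm_of_nonneg (Real.sqrt_nonneg _),
      show Real.pi / (l ^ 2 / 2) = 2 * Real.pi / l ^ 2 by field_simp,
      Real.sqrt_div (by positivity), Real.sqrt_sq hl0.le, mul_div_cancel₀ _ hl0.ne']
    exact Real.one_le_sqrt.2 (by nlinarith [Real.pi_gt_three])
  set q : ℝ → ℝ := fun s => Real.exp (-(1 / 4) * s ^ 2) with hq
  have hqi : Integrable q := integrable_exp_neg_mul_sq (by norm_num)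
  have hpq := hψi.norm.integrable_convolution (ContinuousLinearMap.mul ℝ ℝ) hqi
  have hpqint := integral_convolution (μ := volume) (ν := volume)
    (ContinuousLinearMap.mul ℝ ℝ) hψi.norm hqi
  set E := Real.exp (-(c₁ * l)) with hE
  have hpt (y₀ : ℝ) : ‖(MeasureTheory.convolution f g (ContinuousLinearMap.mul ℝ ℂ)) y₀‖ ≤
      K.indicator (fun _ => |C| * E) y₀ +
        E * (MeasureTheory.convolution (fun y => ‖ψ y‖) q (ContinuousLinearMap.mul ℝ ℝ)) y₀ := by
    have hnn : 0 ≤ (MeasureTheory.convolution (fun y => ‖ψ y‖) q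
        (ContinuousLinearMap.mul ℝ ℝ)) y₀ :=
      integral_nonneg fun y => by
        simp only [ContinuousLinearMap.mul_apply', hq]; positivity
    have hE0 : 0 < E := Real.exp_pos _
    by_cases hy : y₀ ∈ K
    · rw [Set.indicator_of_mem hy]
      refine le_add_of_le_of_nonneg ?_ (by positivity)
      have := h l hRl y₀ hy
      have e : (MeasureTheory.convolution f g (ContinuousLinearMap.mul ℝ ℂ)) y₀ =
          ∫ y : ℝ, ((ψ y : ℂ) * cexp (I * l ^ 2 * y)) * cexp (-(l ^ 2 * (y₀ - y) ^ 2 / 2)) := by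
        rw [convolution_def]
        congr 1; ext y
        simp only [ContinuousLinearMap.mul_apply', hf, hg]
        congr 2; push_cast; ring
      rw [e]
      refine this.trans ?_
      have : Real.exp (-(c * l)) ≤ E := by
        apply Real.exp_le_exp.2
        have := mul_le_mul_of_nonneg_right (min_le_left c (d ^ 2 / 4)) hl0.le
        linarith
      calc _ ≤ |C| * Real.exp (-(c * l)) := by gcongr; exact le_abs_self C
        _ ≤ _ := by gcongr
    · rw [Set.indicator_of_notMem hy, zero_add, convolution_def, convolution_def,
        ← integral_const_mul]
      refine norm_integral_le_of_norm_le ?_ (.of_forall fun y => ?_)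
      · apply Integrable.const_mul
        apply Continuous.integrable_of_hasCompactSupport
        · simp only [ContinuousLinearMap.mul_apply', hq]; fun_prop
        · simp only [ContinuousLinearMap.mul_apply']; exact hcs.norm.mul_right
      simp only [ContinuousLinearMap.mul_apply', norm_mul]
      rw [hfn, hgn]
      by_cases hys : ψ y = 0
      · simp [hys]
      have hyt : y ∈ tsupport ψ := subset_tsupport _ hys
      have hdist : d < |y₀ - y| := by
        by_contra hcon
        exact hy (Metric.mem_cthickening_of_dist_le y₀ y d _ hyt
          (by rw [Real.dist_eq]; exact not_lt.1 hcon))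
      have hsq : d ^ 2 ≤ (y₀ - y) ^ 2 := by rw [← sq_abs (y₀ - y)]; gcongr
      have : Real.exp (-(l ^ 2 / 2) * (y₀ - y) ^ 2) ≤ E * q (y₀ - y) := by
        rw [hE, hq, ← Real.exp_add]
        apply Real.exp_le_exp.2
        have h1 : c₁ * l ≤ d ^ 2 / 4 * l ^ 2 := by
          calc c₁ * l ≤ d ^ 2 / 4 * l := by gcongr; exact min_le_right _ _
            _ ≤ d ^ 2 / 4 * l ^ 2 := by gcongr; nlinarith
        nlinarith [mul_nonneg (sub_nonneg.2 hsq) (sq_nonneg l),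
          mul_nonneg (sq_nonneg (y₀ - y)) (by nlinarith : (0 : ℝ) ≤ l ^ 2 - 1)]
      calc _ ≤ ‖ψ y‖ * (E * q (y₀ - y)) := by gcongr
        _ = _ := by ring
  have hmain : ‖∫ y, f y‖ * ‖∫ s, g s‖ ≤ D * E := by
    rw [← norm_mul]
    rw [ContinuousLinearMap.mul_apply'] at hconv
    rw [← hconv]
    have iK : Integrable (K.indicator fun _ => |C| * E) :=
      (integrableOn_const (hs := hKc.measure_lt_top.ne)).integrable_indicator hKc.measurableSet
    refine (norm_integral_le_of_norm_le (iK.add (hpq.const_mul E)) (.of_forall hpt)).trans ?_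
    rw [integral_add' iK (hpq.const_mul E), integral_const_mul, hpqint,
      integral_indicator_const _ hKc.measurableSet, ContinuousLinearMap.mul_apply',
      hq, integral_gaussian, smul_eq_mul, hD, show Real.pi / (1 / 4) = 4 * Real.pi by ring]
    apply le_of_eq
    ring
  calc ‖∫ y : ℝ, (ψ y : ℂ) * cexp (I * ξ * y)‖ = ‖∫ y, f y‖ := by
        rw [hf]; simp only; rw [← hl2]; push_cast; rfl
    _ ≤ ‖∫ y, f y‖ * (l * ‖∫ s, g s‖) := le_mul_of_one_le_right (norm_nonneg _) hgint
    _ = l * (‖∫ y, f y‖ * ‖∫ s, g s‖) := by ring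
    _ ≤ l * (D * E) := by gcongr
    _ = D * (l * E) := by ring
    _ ≤ D * (2 / c₁ * Real.exp (-(c₁ / 2 * l))) := by
        refine mul_le_mul_of_nonneg_left ?_ hD0
        simpa using pow_mul_exp_neg_le hc₁0 hl0.le 1
    _ = _ := by ring

/-! ### Complex Gaussian moments of the initial profile -/

/-- The closed rectangle in the complex `ρ`-plane in which contours are moved. On it `ρ²` stays in
the right half plane, so that `e^{-l²ρ²x²/2}` remains a decaying Gaussian. -/
def contourRect : Set ℂ := Set.Icc (1 / 2 : ℝ) (3 / 2) ×ℂ Set.Icc (-(1 / 4) : ℝ) (1 / 4)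

theorem mem_contourRect {ρ : ℂ} :
    ρ ∈ contourRect ↔ (1 / 2 ≤ ρ.re ∧ ρ.re ≤ 3 / 2) ∧ (-(1 / 4) ≤ ρ.im ∧ ρ.im ≤ 1 / 4) := by
  simp [contourRect, mem_reProdIm]

theorem ofReal_mem_contourRect {r : ℝ} (hr : r ∈ Set.Icc (1 / 2 : ℝ) (3 / 2)) :
    (r : ℂ) ∈ contourRect := by
  rw [mem_contourRect]; simp only [ofReal_re, ofReal_im]
  exact ⟨hr, by norm_num, by norm_num⟩

theorem norm_le_two_of_mem_contourRect {ρ : ℂ} (h : ρ ∈ contourRect) : ‖ρ‖ ≤ 2 := by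
  obtain ⟨⟨h1, h2⟩, h3, h4⟩ := mem_contourRect.1 h
  rw [← sq_le_sq₀ (norm_nonneg _) (by norm_num), ← normSq_eq_norm_sq, normSq_apply]
  nlinarith

theorem re_sq_of_mem_contourRect {ρ : ℂ} (h : ρ ∈ contourRect) : 3 / 16 ≤ (ρ ^ 2).re := by
  obtain ⟨⟨h1, h2⟩, h3, h4⟩ := mem_contourRect.1 h
  rw [sq, mul_re]
  nlinarith

/-- The Gaussian moment `∫ h(x) e^{-l²ρ²x²/2} dx`, as a function of the complex variable `ρ`. -/
noncomputable def gaussianMoment (h : ℝ → ℝ) (l : ℝ) (ρ : ℂ) : ℂ :=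
  ∫ x : ℝ, (h x : ℂ) * cexp (-(l ^ 2 * ρ ^ 2 * x ^ 2 / 2))

theorem differentiable_gaussianMoment {h : ℝ → ℝ} (hh : Continuous h) (hc : HasCompactSupport h)
    (l : ℝ) : Differentiable ℂ (gaussianMoment h l) := by
  intro ρ₀
  set D := ‖ρ₀‖ + 1 with hD
  have hcC : HasCompactSupport fun x : ℝ => (h x : ℂ) :=
    hc.comp_left (g := fun r : ℝ => (r : ℂ)) (by simp)
  refine (hasDerivAt_integral_of_dominated_loc_of_deriv_le (𝕜 := ℂ) (μ := volume)
    (F := fun (ρ : ℂ) (x : ℝ) => (h x : ℂ) * cexp (-(l ^ 2 * ρ ^ 2 * x ^ 2 / 2)))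
    (F' := fun (ρ : ℂ) (x : ℝ) => (h x : ℂ) *
      (cexp (-(l ^ 2 * ρ ^ 2 * x ^ 2 / 2)) * -(l ^ 2 * ρ * x ^ 2)))
    (bound := fun x => |h x| * (Real.exp (l ^ 2 * D ^ 2 * x ^ 2 / 2) * (l ^ 2 * D * x ^ 2)))
    (Metric.ball_mem_nhds ρ₀ one_pos) ?_ ?_ ?_ ?_ ?_ ?_).2.differentiableAt
  · exact .of_forall fun ρ => Continuous.aestronglyMeasurable (by fun_prop)
  · exact Continuous.integrable_of_hasCompactSupport (by fun_prop) hcC.mul_right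
  · exact Continuous.aestronglyMeasurable (by fun_prop)
  · refine .of_forall fun x ρ hρ => ?_
    have hρD : ‖ρ‖ ≤ D := by
      have := norm_le_norm_add_norm_sub' ρ ρ₀
      rw [mem_ball_iff_norm] at hρ
      linarith
    rw [norm_mul, norm_real, norm_mul, Real.norm_eq_abs]
    gcongr
    · rw [norm_exp]
      apply Real.exp_le_exp.2
      refine (re_le_norm _).trans ?_
      simp only [norm_neg, norm_div, norm_mul, norm_pow, norm_real, norm_ofNat,
        Real.norm_eq_abs, sq_abs]
      gcongr
    · simp only [norm_neg, norm_mul, norm_pow, norm_real, Real.norm_eq_abs, sq_abs]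
      gcongr
  · refine Continuous.integrable_of_hasCompactSupport (by fun_prop) ?_
    exact HasCompactSupport.mul_right (by simpa using hc.norm)
  · refine .of_forall fun x ρ _ => ?_
    have h1 : HasDerivAt (fun ρ : ℂ => -((l : ℂ) ^ 2 * ρ ^ 2 * (x : ℂ) ^ 2 / 2))
        (-(l ^ 2 * ρ * x ^ 2)) ρ := by
      have := ((((hasDerivAt_pow 2 ρ).const_mul ((l : ℂ) ^ 2)).mul_const ((x : ℂ) ^ 2)).div_const
        2).neg
      convert! this using 1
      simp only [Nat.cast_ofNat]
      ring
    exact (h1.cexp).const_mul _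

theorem one_le_norm_integral_gaussian_of_mem_contourRect {ρ : ℂ} (h : ρ ∈ contourRect) :
    1 ≤ ‖∫ x : ℝ, cexp (-(ρ ^ 2 / 2) * x ^ 2)‖ := by
  have hre := re_sq_of_mem_contourRect h
  have hb : 0 < (ρ ^ 2 / 2).re := by
    rw [show (ρ ^ 2 / 2 : ℂ) = ((1 / 2 : ℝ) : ℂ) * ρ ^ 2 by push_cast; ring, re_ofReal_mul]
    linarith
  have h0 : ρ ≠ 0 := by
    rintro rfl; norm_num at hre
  have hsq := congrArg norm (integral_gaussian_sq_complex hb)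
  rw [norm_pow, norm_div, norm_real, Real.norm_of_nonneg Real.pi_pos.le, norm_div, norm_pow,
    norm_ofNat] at hsq
  have hρ := norm_le_two_of_mem_contourRect h
  have hρ0 : 0 < ‖ρ‖ := norm_pos_iff.2 h0
  by_contra hcon
  have hlt : ‖∫ x : ℝ, cexp (-(ρ ^ 2 / 2) * x ^ 2)‖ ^ 2 < 1 := by
    have := norm_nonneg (∫ x : ℝ, cexp (-(ρ ^ 2 / 2) * x ^ 2))
    nlinarith
  rw [hsq, div_lt_one (by positivity)] at hlt
  nlinarith [Real.pi_gt_three]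

/-- After rescaling by `l`, the Gaussian moments of `h` tend to those of the constant `h 0`,
uniformly in the contour rectangle, so they are bounded below. -/
theorem exists_le_norm_gaussianMoment {h : ℝ → ℝ} (hh : Continuous h) (hc : HasCompactSupport h)
    (h0 : h 0 ≠ 0) :
    ∃ c R : ℝ, 0 < c ∧ ∀ l : ℝ, R ≤ l → ∀ ρ ∈ contourRect, c ≤ ‖(l : ℂ) * gaussianMoment h l ρ‖ := by
  obtain ⟨B, hB⟩ := hh.bounded_above_of_compact_support hc
  set q : ℝ → ℝ := fun x => Real.exp (-(3 / 32) * x ^ 2) with hq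
  have hqi : Integrable q := integrable_exp_neg_mul_sq (by norm_num)
  have hlim : Filter.Tendsto (fun l : ℝ => ∫ x : ℝ, |h (x / l) - h 0| * q x) Filter.atTop
      (nhds (∫ x : ℝ, |h 0 - h 0| * q x)) := by
    refine tendsto_integral_filter_of_dominated_convergence (fun x => (2 * B) * q x)
      (.of_forall fun l => ?_) (.of_forall fun l => .of_forall fun x => ?_) (hqi.const_mul _)
      (.of_forall fun x => ?_)
    · simp only [hq]
      exact Continuous.aestronglyMeasurable (by fun_prop)
    · rw [norm_mul, Real.norm_of_nonneg (show 0 ≤ q x from (Real.exp_pos _).le), Real.norm_eq_abs,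
        abs_abs]
      have := Real.exp_pos (-(3 / 32) * x ^ 2)
      refine mul_le_mul_of_nonneg_right ?_ this.le
      refine (abs_sub _ _).trans ?_
      have h1 := hB (x / l)
      have h2 := hB 0
      rw [Real.norm_eq_abs] at h1 h2
      linarith
    · have h1 : Filter.Tendsto (fun l : ℝ => x / l) Filter.atTop (nhds 0) :=
        tendsto_const_nhds.div_atTop Filter.tendsto_id
      exact (((hh.tendsto 0).comp h1).sub_const _).abs.mul_const _
  simp only [sub_self, abs_zero, zero_mul, integral_zero] at hlim
  have hev := (hlim.eventually (gt_mem_nhds (show 0 < |h 0| / 2 by positivity))).and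
    (Filter.eventually_gt_atTop 0)
  obtain ⟨R, hR⟩ := Filter.eventually_atTop.1 hev
  refine ⟨|h 0| / 2, R, by positivity, fun l hl ρ hρ => ?_⟩
  obtain ⟨hlt, hl0⟩ := hR l hl
  have hlC : (l : ℂ) ≠ 0 := by exact_mod_cast hl0.ne'
  set g : ℝ → ℂ := fun x => cexp (-(ρ ^ 2 / 2) * x ^ 2) with hg
  have hre := re_sq_of_mem_contourRect hρ
  have hb : 3 / 32 ≤ (ρ ^ 2 / 2).re := by
    rw [show (ρ ^ 2 / 2 : ℂ) = ((1 / 2 : ℝ) : ℂ) * ρ ^ 2 by push_cast; ring, re_ofReal_mul]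
    linarith
  have hgn (x : ℝ) : ‖g x‖ ≤ q x := by
    rw [hg, hq]; simp only
    rw [norm_exp]
    apply Real.exp_le_exp.2
    rw [show (-(ρ ^ 2 / 2) * (x : ℂ) ^ 2) = ((-x ^ 2 : ℝ) : ℂ) * (ρ ^ 2 / 2) by push_cast; ring,
      re_ofReal_mul]
    nlinarith [sq_nonneg x]
  have hgc : Continuous g := by fun_prop
  have hgi : Integrable g := hqi.mono' hgc.aestronglyMeasurable (.of_forall hgn)
  have hscale : (l : ℂ) * gaussianMoment h l ρ = ∫ x : ℝ, (h (x / l) : ℂ) * g x := by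
    have := Measure.integral_comp_div (fun x : ℝ => (h x : ℂ) * g (l * x)) l
    rw [abs_of_pos hl0, real_smul] at this
    calc (l : ℂ) * gaussianMoment h l ρ = (l : ℂ) * ∫ x : ℝ, (h x : ℂ) * g (l * x) := by
          rw [gaussianMoment]; congr 2; ext x; rw [hg]; simp only; congr 2; push_cast; ring
      _ = _ := by
          rw [← this]; congr 1; ext x; rw [mul_div_cancel₀ _ hl0.ne']
  have hi : Integrable fun x : ℝ => (h (x / l) : ℂ) * g x := by
    refine (hqi.const_mul B).mono' (Continuous.aestronglyMeasurable (by fun_prop))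
      (.of_forall fun x => ?_)
    rw [norm_mul, norm_real]
    exact mul_le_mul (hB _) (hgn x) (norm_nonneg _) ((norm_nonneg _).trans (hB 0))
  have hdiff : ‖(l : ℂ) * gaussianMoment h l ρ - (h 0 : ℂ) * ∫ x : ℝ, g x‖ ≤
      ∫ x : ℝ, |h (x / l) - h 0| * q x := by
    rw [hscale, ← integral_const_mul, ← integral_sub hi (hgi.const_mul _)]
    refine norm_integral_le_of_norm_le ?_ (.of_forall fun x => ?_)
    · refine (hqi.const_mul (2 * B)).mono' (Continuous.aestronglyMeasurable (by fun_prop))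
        (.of_forall fun x => ?_)
      have hq0 : 0 ≤ q x := (Real.exp_pos _).le
      rw [norm_mul, Real.norm_of_nonneg hq0, Real.norm_eq_abs, abs_abs]
      refine mul_le_mul_of_nonneg_right ?_ hq0
      refine (abs_sub _ _).trans ?_
      have h1 := hB (x / l)
      have h2 := hB 0
      rw [Real.norm_eq_abs] at h1 h2
      linarith
    · rw [← sub_mul, norm_mul, ← ofReal_sub, norm_real, Real.norm_eq_abs]
      gcongr
      exact hgn x
  have hone := one_le_norm_integral_gaussian_of_mem_contourRect hρ
  have hmain : |h 0| ≤ ‖(h 0 : ℂ) * ∫ x : ℝ, g x‖ := by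
    rw [norm_mul, norm_real, Real.norm_eq_abs]
    exact le_mul_of_one_le_right (abs_nonneg _) hone
  have := norm_sub_norm_le ((h 0 : ℂ) * ∫ x : ℝ, g x) ((l : ℂ) * gaussianMoment h l ρ)
  rw [norm_sub_rev] at this
  linarith

/-! ### Exponentially small superpositions of modes -/

/-- The exponent of the mode `e^{i l²ρ² s - l²ρ²x²/2 - κ l ρ t}` of the adjoint system, where `s` is
the distance in `y` to the base point. -/
noncomputable def modeExponent (κ : ℂ) (l t x s : ℝ) (ρ : ℂ) : ℂ :=
  I * l ^ 2 * ρ ^ 2 * s - l ^ 2 * ρ ^ 2 * x ^ 2 / 2 - κ * l * ρ * t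

theorem re_packet_exponent (κ : ℂ) (l t x s r v : ℝ) :
    (-(l ^ 2 * ((r + v * I : ℂ) ^ 2 - 1) ^ 2 / 2) + modeExponent κ l t x s (r + v * I)).re =
      -(l ^ 2 * ((r ^ 2 - v ^ 2 - 1) ^ 2 / 2 - 2 * r ^ 2 * v ^ 2 + 2 * r * v * s +
        (r ^ 2 - v ^ 2) * x ^ 2 / 2)) - l * t * (κ.re * r - κ.im * v) := by
  have h1 : (-(l ^ 2 * ((r + v * I : ℂ) ^ 2 - 1) ^ 2 / 2) +
      modeExponent κ l t x s (r + v * I)) =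
      ((-(l ^ 2 * ((r ^ 2 - v ^ 2 - 1) ^ 2 / 2 - 2 * r ^ 2 * v ^ 2 + 2 * r * v * s +
        (r ^ 2 - v ^ 2) * x ^ 2 / 2)) - l * t * (κ.re * r - κ.im * v) : ℝ) : ℂ) +
      ((-(l ^ 2 * (2 * (r ^ 2 - v ^ 2 - 1) * (2 * r * v)) / 2) + l ^ 2 * (r ^ 2 - v ^ 2) * s -
        l ^ 2 * (2 * r * v) * x ^ 2 / 2 - l * t * (κ.re * v + κ.im * r) : ℝ) : ℂ) * I := by
    rw [modeExponent]
    conv_lhs => rw [← re_add_im κ]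
    push_cast
    ring_nf
    simp only [show (I : ℂ) ^ 4 = 1 from I_pow_four, show (I : ℂ) ^ 3 = -I from I_pow_three,
      I_sq]
    ring
  rw [h1, add_re, ofReal_re, re_ofReal_mul, I_re, mul_zero, add_zero]

theorem norm_packet_integrand (κ : ℂ) (l t x s r v : ℝ) (k : ℂ → ℂ) :
    ‖k (r + v * I) * (cexp (-(l ^ 2 * ((r + v * I : ℂ) ^ 2 - 1) ^ 2 / 2)) *
      cexp (modeExponent κ l t x s (r + v * I)))‖ = ‖k (r + v * I)‖ *
      Real.exp (-(l ^ 2 * ((r ^ 2 - v ^ 2 - 1) ^ 2 / 2 - 2 * r ^ 2 * v ^ 2 + 2 * r * v * s +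
        (r ^ 2 - v ^ 2) * x ^ 2 / 2)) - l * t * (κ.re * r - κ.im * v)) := by
  rw [← Complex.exp_add, norm_mul, norm_exp, re_packet_exponent]

/-- On the three shifted or vertical sides of the contour the packet is small at distance at least
`d` from its base point. The factor `e^{i l²ρ²s}` gains `2 l² r |v| |s|`, the Gaussian weight loses
`2 l² r² v²`, and `τ ≤ d / 3` ensures that the gain wins; the vertical sides are in any case far
from the centre `ρ = 1` of the weight. The growth `2 l ‖κ‖ T` of the time factor for complex `ρ` is
linear in `l`, hence absorbed. -/
theorem packet_exponent_le {κ : ℂ} {T d τ m : ℝ} (hτ0 : 0 < τ) (hτ : τ ≤ 1 / 4)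
    (hτd : τ ≤ d / 3) (hm : 0 < m) (hm1 : m ≤ τ * d / 2) (hm2 : m ≤ 9 / 32)
    {l t x s r v : ℝ} (hl : 0 ≤ l) (ht0 : 0 ≤ t) (htT : t ≤ T) (hs : d ≤ |s|)
    (hr : r ∈ Set.Icc (1 / 2 : ℝ) (3 / 2)) (hv : |v| ≤ τ) (hvs : 0 ≤ v * s)
    (hside : |v| = τ ∨ r = 1 / 2 ∨ r = 3 / 2) :
    -(l ^ 2 * ((r ^ 2 - v ^ 2 - 1) ^ 2 / 2 - 2 * r ^ 2 * v ^ 2 + 2 * r * v * s +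
        (r ^ 2 - v ^ 2) * x ^ 2 / 2)) - l * t * (κ.re * r - κ.im * v) ≤
      (2 * ‖κ‖ * T + 1) ^ 2 / (4 * m) - l := by
  obtain ⟨hr1, hr2⟩ := hr
  have hv0 := abs_nonneg v
  have hvs' : v * s = |v| * |s| := by rw [← abs_mul, abs_of_nonneg hvs]
  have hv2 : v ^ 2 ≤ 1 / 16 := by rw [← sq_abs]; nlinarith
  have hx : 0 ≤ (r ^ 2 - v ^ 2) * x ^ 2 / 2 := by
    have : 0 ≤ r ^ 2 - v ^ 2 := by nlinarith
    positivity
  have hshift : r * |v| * d ≤ -(2 * r ^ 2 * v ^ 2) + 2 * r * v * s := by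
    have e : -(2 * r ^ 2 * v ^ 2) + 2 * r * v * s = 2 * (r * |v|) * (|s| - r * |v|) := by
      rw [← sq_abs v]; linear_combination 2 * r * hvs'
    rw [e]
    have h1 : r * |v| ≤ d / 2 := by nlinarith
    have h2 : 0 ≤ r * |v| := by positivity
    nlinarith
  have hd : 0 < d := by linarith
  have hlow : m ≤ (r ^ 2 - v ^ 2 - 1) ^ 2 / 2 - 2 * r ^ 2 * v ^ 2 + 2 * r * v * s +
      (r ^ 2 - v ^ 2) * x ^ 2 / 2 := by
    rcases hside with h | h | h
    · have : τ * d / 2 ≤ r * |v| * d := by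
        rw [h]; nlinarith [mul_pos hτ0 hd]
      nlinarith [sq_nonneg (r ^ 2 - v ^ 2 - 1)]
    · have h1 : 9 / 16 ≤ (r ^ 2 - v ^ 2 - 1) ^ 2 := by
        rw [h]; nlinarith [sq_nonneg v]
      have : 0 ≤ r * |v| * d := by positivity
      linarith
    · have h1 : 9 / 16 ≤ (r ^ 2 - v ^ 2 - 1) ^ 2 := by
        rw [h]; nlinarith [sq_nonneg v]
      have : 0 ≤ r * |v| * d := by positivity
      linarith
  have hκ : -(κ.re * r - κ.im * v) ≤ 2 * ‖κ‖ := by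
    have h1 := abs_re_le_norm κ
    have h2 := abs_im_le_norm κ
    have h3 : -(κ.re * r) ≤ ‖κ‖ * (3 / 2) := by
      calc -(κ.re * r) ≤ |κ.re * r| := neg_le_abs _
        _ = |κ.re| * r := by rw [abs_mul, abs_of_nonneg (by linarith : 0 ≤ r)]
        _ ≤ _ := by gcongr
    have h4 : κ.im * v ≤ ‖κ‖ * (1 / 2) := by
      calc κ.im * v ≤ |κ.im * v| := le_abs_self _
        _ = |κ.im| * |v| := abs_mul _ _
        _ ≤ _ := by gcongr; linarith
    linarith
  have h1 : -(l * t * (κ.re * r - κ.im * v)) ≤ l * (2 * ‖κ‖ * T) := by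
    calc _ = l * (t * -(κ.re * r - κ.im * v)) := by ring
      _ ≤ l * (t * (2 * ‖κ‖)) := by gcongr
      _ ≤ l * (T * (2 * ‖κ‖)) := by gcongr
      _ = _ := by ring
  have h2 : l ^ 2 * m ≤ l ^ 2 * ((r ^ 2 - v ^ 2 - 1) ^ 2 / 2 - 2 * r ^ 2 * v ^ 2 +
      2 * r * v * s + (r ^ 2 - v ^ 2) * x ^ 2 / 2) := by gcongr
  have h3 : -(l ^ 2 * m) + l * (2 * ‖κ‖ * T + 1) ≤ (2 * ‖κ‖ * T + 1) ^ 2 / (4 * m) := by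
    rw [le_div_iff₀ (by positivity)]
    nlinarith [sq_nonneg (2 * l * m - (2 * ‖κ‖ * T + 1))]
  linarith

theorem differentiable_modeExponent (κ : ℂ) (l t x s : ℝ) :
    Differentiable ℂ (modeExponent κ l t x s) := by
  unfold modeExponent; fun_prop

/-- The superposition of the decaying adjoint modes with a Gaussian weight is `O(e^{-cl})` at
positive times, away from `x = 0`, and away from the base point in `y`. In the last case the
contour of integration is moved off the real axis, in the direction given by the sign of `s`. -/
theorem exists_norm_packet_le {κ : ℂ} (hκ : 0 < κ.re) {T T₁ δ d : ℝ} (hT₁ : 0 < T₁) (hδ : 0 < δ)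
    (hd : 0 < d) :
    ∃ C c : ℝ, 0 < c ∧ ∀ (k : ℂ → ℂ) (M l t x s : ℝ), DifferentiableOn ℂ k contourRect →
      (∀ ρ ∈ contourRect, ‖k ρ‖ ≤ M) → 1 ≤ l → 0 ≤ t → t ≤ T → (T₁ ≤ t ∨ δ ≤ |x| ∨ d ≤ |s|) →
      ‖∫ ρ in (1 / 2 : ℝ)..(3 / 2), k ρ * (cexp (-(l ^ 2 * ((ρ : ℂ) ^ 2 - 1) ^ 2 / 2)) *
        cexp (modeExponent κ l t x s ρ))‖ ≤ M * C * Real.exp (-(c * l)) := by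
  set τ := min (1 / 4) (d / 3) with hτ
  have hτ0 : 0 < τ := by positivity
  have hτ4 : τ ≤ 1 / 4 := min_le_left _ _
  have hτd : τ ≤ d / 3 := min_le_right _ _
  set m := min (τ * d / 2) (9 / 32) with hm
  have hm0 : 0 < m := by positivity
  set A := (2 * ‖κ‖ * T + 1) ^ 2 / (4 * m) with hA
  have hA0 : 0 ≤ A := by positivity
  set c := min 1 (min (κ.re * T₁ / 2) (δ ^ 2 / 8)) with hc
  have hc0 : 0 < c := by positivity
  refine ⟨3 * Real.exp A, c, hc0, fun k M l t x s hk hkM hl ht0 htT hfar => ?_⟩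
  have hM0 : 0 ≤ M := (norm_nonneg _).trans (hkM _ (ofReal_mem_contourRect (r := 1) (by norm_num)))
  have hl0 : 0 ≤ l := by linarith
  have hcl (b : ℝ) (hb : c ≤ b) : Real.exp (-(b * l)) ≤ Real.exp (-(c * l)) := by
    apply Real.exp_le_exp.2; nlinarith
  have hreal (b : ℝ) (hb : c ≤ b)
      (hexp : ∀ r ∈ Set.Icc (1 / 2 : ℝ) (3 / 2), b * l ≤ l ^ 2 * (r ^ 2 * x ^ 2 / 2) +
        l * t * (κ.re * r)) :
      ‖∫ ρ in (1 / 2 : ℝ)..(3 / 2), k ρ * (cexp (-(l ^ 2 * ((ρ : ℂ) ^ 2 - 1) ^ 2 / 2)) *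
        cexp (modeExponent κ l t x s ρ))‖ ≤ M * (3 * Real.exp A) * Real.exp (-(c * l)) := by
    refine (intervalIntegral.norm_integral_le_of_norm_le_const
      (C := M * Real.exp (-(c * l))) fun r hr => ?_).trans ?_
    · rw [Set.uIoc_of_le (by norm_num)] at hr
      have hr' : r ∈ Set.Icc (1 / 2 : ℝ) (3 / 2) := Set.Ioc_subset_Icc_self hr
      have := norm_packet_integrand κ l t x s r 0 k
      simp only [ofReal_zero, zero_mul, add_zero] at this
      rw [this]
      refine mul_le_mul (hkM _ (ofReal_mem_contourRect hr')) ?_ (Real.exp_pos _).le hM0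
      refine le_trans (Real.exp_le_exp.2 ?_) (hcl b hb)
      have := hexp r hr'
      have h0 := mul_nonneg (sq_nonneg l) (sq_nonneg (r ^ 2 - 1))
      nlinarith
    · have h1 : (1 : ℝ) ≤ 3 * Real.exp A := by
        have := Real.one_le_exp hA0; linarith
      rw [show |(3 / 2 : ℝ) - 1 / 2| = 1 by norm_num, mul_one, mul_assoc]
      gcongr
      exact le_mul_of_one_le_left (Real.exp_pos _).le h1
  rcases hfar with hfar | hfar | hfar
  · refine hreal (κ.re * T₁ / 2) ((min_le_right _ _).trans (min_le_left _ _)) fun r hr => ?_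
    have h1 : κ.re * T₁ / 2 ≤ t * (κ.re * r) := by
      have : κ.re * (1 / 2) ≤ κ.re * r := by gcongr; exact hr.1
      calc κ.re * T₁ / 2 = T₁ * (κ.re * (1 / 2)) := by ring
        _ ≤ _ := by gcongr
    have h2 : 0 ≤ l ^ 2 * (r ^ 2 * x ^ 2 / 2) := by positivity
    nlinarith
  · refine hreal (δ ^ 2 / 8) ((min_le_right _ _).trans (min_le_right _ _)) fun r hr => ?_
    have h1 : 0 ≤ l * t * (κ.re * r) := by
      have : 0 ≤ r := by linarith [hr.1]
      positivity
    have h2 : δ ^ 2 ≤ x ^ 2 := by rw [← sq_abs x]; gcongr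
    have h3 : δ ^ 2 / 8 ≤ r ^ 2 * x ^ 2 / 2 := by
      have : (1 / 4 : ℝ) ≤ r ^ 2 := by nlinarith [hr.1]
      nlinarith [sq_nonneg δ]
    have h4 : l ≤ l ^ 2 := by nlinarith
    calc δ ^ 2 / 8 * l ≤ (r ^ 2 * x ^ 2 / 2) * l ^ 2 := by gcongr
      _ ≤ _ := by linarith
  · obtain ⟨w, hwτ, hws⟩ : ∃ w : ℝ, |w| = τ ∧ 0 ≤ w * s := by
      rcases le_total 0 s with h | h
      · exact ⟨τ, abs_of_pos hτ0, by positivity⟩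
      · exact ⟨-τ, by rw [abs_neg, abs_of_pos hτ0], by nlinarith⟩
    have hvw (v : ℝ) (hv : v ∈ Set.uIcc 0 w) : |v| ≤ τ ∧ 0 ≤ v * s := by
      rcases le_total 0 w with h | h
      · rw [Set.uIcc_of_le h] at hv
        rw [abs_of_nonneg h] at hwτ
        refine ⟨by rw [abs_of_nonneg hv.1]; linarith [hv.2], ?_⟩
        rcases h.eq_or_lt with h' | h'
        · linarith
        · exact mul_nonneg hv.1 (nonneg_of_mul_nonneg_right hws h')
      · rw [Set.uIcc_of_ge h] at hv
        rw [abs_of_nonpos h] at hwτ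
        refine ⟨by rw [abs_of_nonpos hv.2]; linarith [hv.1], ?_⟩
        rcases h.eq_or_lt with h' | h'
        · linarith
        · exact mul_nonneg_of_nonpos_of_nonpos hv.2 (by nlinarith)
    set F : ℂ → ℂ := fun ρ => k ρ * (cexp (-(l ^ 2 * (ρ ^ 2 - 1) ^ 2 / 2)) *
      cexp (modeExponent κ l t x s ρ)) with hF
    have hFb (r v : ℝ) (hr : r ∈ Set.Icc (1 / 2 : ℝ) (3 / 2)) (hv : v ∈ Set.uIcc 0 w)
        (hside : |v| = τ ∨ r = 1 / 2 ∨ r = 3 / 2) :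
        ‖F (r + v * I)‖ ≤ M * (Real.exp A * Real.exp (-(c * l))) := by
      obtain ⟨hv1, hv2⟩ := hvw v hv
      rw [hF]; simp only
      rw [norm_packet_integrand]
      refine mul_le_mul (hkM _ ?_) ?_ (Real.exp_pos _).le hM0
      · rw [mem_contourRect]
        simp only [add_re, ofReal_re, mul_re, I_re, mul_zero, ofReal_im, I_im, mul_one, sub_self,
          add_zero, add_im, mul_im, zero_add]
        have := abs_le.1 hv1
        exact ⟨hr, by linarith, by linarith⟩
      · refine (Real.exp_le_exp.2 (packet_exponent_le hτ0 hτ4 hτd hm0 (min_le_left _ _)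
          (min_le_right _ _) hl0 ht0 htT hfar hr hv1 hv2 hside)).trans ?_
        rw [sub_eq_add_neg, Real.exp_add, ← hA]
        gcongr
        exact mul_le_of_le_one_left hl0 (min_le_left _ _)
    have hFd : DifferentiableOn ℂ F contourRect := by
      refine hk.mul (Differentiable.differentiableOn ?_)
      have := differentiable_modeExponent κ l t x s
      fun_prop
    have hrect := integral_boundary_rect_eq_zero_of_differentiableOn F (1 / 2 : ℝ)
      ((3 / 2 : ℝ) + w * I) (hFd.mono (by
        intro ρ hρ
        rw [mem_reProdIm] at hρ
        simp only [add_re, ofReal_re, mul_re, I_re, mul_zero, ofReal_im, I_im, mul_one, sub_self,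
          add_zero, add_im, mul_im, zero_add] at hρ
        rw [Set.uIcc_of_le (by norm_num)] at hρ
        have := abs_le.1 (hvw _ hρ.2).1
        exact mem_contourRect.2 ⟨hρ.1, by linarith, by linarith⟩))
    simp only [add_re, ofReal_re, mul_re, I_re, mul_zero, ofReal_im, I_im, mul_one, sub_self,
      add_zero, add_im, mul_im, zero_add, ofReal_zero, zero_mul] at hrect
    have htop : ‖∫ r in (1 / 2 : ℝ)..(3 / 2), F (r + w * I)‖ ≤
        M * (Real.exp A * Real.exp (-(c * l))) := by
      refine (intervalIntegral.norm_integral_le_of_norm_le_const fun r hr => ?_).trans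
        (b := M * (Real.exp A * Real.exp (-(c * l))) * |(3 / 2 : ℝ) - 1 / 2|) (by norm_num)
      rw [Set.uIoc_of_le (by norm_num)] at hr
      exact hFb r w (Set.Ioc_subset_Icc_self hr) Set.right_mem_uIcc (Or.inl hwτ)
    have hvert (r : ℝ) (hr : r = 1 / 2 ∨ r = 3 / 2) : ‖∫ v in (0 : ℝ)..w, F (r + v * I)‖ ≤
        M * (Real.exp A * Real.exp (-(c * l))) := by
      refine (intervalIntegral.norm_integral_le_of_norm_le_const
        (C := M * (Real.exp A * Real.exp (-(c * l)))) fun v hv => ?_).trans ?_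
      · refine hFb r v ?_ (Set.uIoc_subset_uIcc hv) (Or.inr hr)
        rcases hr with h | h <;> rw [h] <;> norm_num
      · rw [sub_zero, hwτ]
        exact mul_le_of_le_one_right (by positivity) (by linarith)
    have heq : (∫ r in (1 / 2 : ℝ)..(3 / 2), F r) =
        (∫ r in (1 / 2 : ℝ)..(3 / 2), F (r + w * I)) -
        I • (∫ v in (0 : ℝ)..w, F ((3 / 2 : ℝ) + v * I)) +
        I • (∫ v in (0 : ℝ)..w, F ((1 / 2 : ℝ) + v * I)) := by
      linear_combination hrect
    rw [heq]
    refine (norm_add_le _ _).trans ?_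
    refine (add_le_add_left (norm_sub_le _ _) _).trans ?_
    rw [norm_smul, norm_smul, norm_I, one_mul, one_mul]
    have h1 := hvert (3 / 2) (Or.inr rfl)
    have h2 := hvert (1 / 2) (Or.inl rfl)
    calc _ ≤ M * (Real.exp A * Real.exp (-(c * l))) + M * (Real.exp A * Real.exp (-(c * l))) +
          M * (Real.exp A * Real.exp (-(c * l))) := by gcongr
      _ = _ := by ring

/-! ### The duality identity on a half space -/

theorem integral_fderiv_apply_eq_zero {F : ℝ × ℝ → ℂ} (hF : ContDiff ℝ 1 F)
    (hc : HasCompactSupport F) (v : ℝ × ℝ) : ∫ q, fderiv ℝ F q v = 0 := by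
  have hd : Continuous fun q => fderiv ℝ F q v :=
    (hF.continuous_fderiv one_ne_zero).clm_apply continuous_const
  have hdc : HasCompactSupport fun q => fderiv ℝ F q v :=
    (hc.fderiv (𝕜 := ℝ)).comp_left (g := fun L : ℝ × ℝ →L[ℝ] ℂ => L v) (by simp)
  have := integral_bilinear_hasLineDerivAt_right_eq_neg_left_of_integrable (μ := volume)
    (f := fun _ : ℝ × ℝ => (1 : ℂ)) (f' := fun _ => 0) (g := F) (g' := fun q => fderiv ℝ F q v)
    (v := v) (B := ContinuousLinearMap.mul ℝ ℂ) (by simp)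
    (by simpa using hd.integrable_of_hasCompactSupport hdc)
    (by simpa using hF.continuous.integrable_of_hasCompactSupport hc)
    (fun x _ => by simpa using (hasFDerivAt_const (𝕜 := ℝ) (1 : ℂ) x).hasLineDerivAt v)
    (fun x _ => (hF.differentiable one_ne_zero x).hasFDerivAt.hasLineDerivAt v)
  simpa using this

theorem hasCompactSupport_comp_prodMk_left {F : ℝ × ℝ × ℝ → ℂ} (hc : HasCompactSupport F)
    (t : ℝ) : HasCompactSupport fun q : ℝ × ℝ => F (t, q) := by
  refine HasCompactSupport.intro (hc.image continuous_snd) fun q hq => ?_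
  exact image_eq_zero_of_notMem_tsupport fun h => hq ⟨(t, q), h, rfl⟩

theorem hasCompactSupport_comp_prodMk_right {F : ℝ × ℝ × ℝ → ℂ} (hc : HasCompactSupport F)
    (q : ℝ × ℝ) : HasCompactSupport fun t : ℝ => F (t, q) := by
  refine HasCompactSupport.intro (hc.image continuous_fst) fun t ht => ?_
  exact image_eq_zero_of_notMem_tsupport fun h => ht ⟨(t, q), h, rfl⟩

theorem integral_halfSpace_fderiv_time {F : ℝ × ℝ × ℝ → ℂ} (hF : ContDiff ℝ 1 F)
    (hc : HasCompactSupport F) :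
    ∫ p in Set.Ioi (0 : ℝ) ×ˢ (Set.univ : Set (ℝ × ℝ)), fderiv ℝ F p (1, 0, 0) =
      -∫ q : ℝ × ℝ, F (0, q) := by
  have hd : Continuous fun p => fderiv ℝ F p (1, 0, 0) :=
    (hF.continuous_fderiv one_ne_zero).clm_apply continuous_const
  have hdc : HasCompactSupport fun p => fderiv ℝ F p (1, 0, 0) :=
    (hc.fderiv (𝕜 := ℝ)).comp_left (g := fun L : ℝ × ℝ × ℝ →L[ℝ] ℂ => L (1, 0, 0)) (by simp)
  rw [Measure.volume_eq_prod, setIntegral_prod _ (hd.integrable_of_hasCompactSupport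
    (μ := (volume : Measure ℝ).prod (volume : Measure (ℝ × ℝ))) hdc).integrableOn,
    Measure.restrict_univ, integral_integral_swap_of_hasCompactSupport
      (f := fun t q => fderiv ℝ F (t, q) (1, 0, 0)) hd hdc, ← integral_neg]
  congr 1; ext q
  have hs : ContDiff ℝ 1 fun t : ℝ => F (t, q) := hF.comp (contDiff_id.prodMk contDiff_const)
  rw [← HasCompactSupport.integral_Ioi_deriv_eq hs (hasCompactSupport_comp_prodMk_right hc q)]
  congr 1; ext t
  have h1 := (hF.differentiable one_ne_zero (t, q)).hasFDerivAt.comp_hasDerivAt t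
    ((hasDerivAt_id t).prodMk (hasDerivAt_const t q))
  exact h1.deriv.symm

theorem integral_halfSpace_fderiv_space {F : ℝ × ℝ × ℝ → ℂ} (hF : ContDiff ℝ 1 F)
    (hc : HasCompactSupport F) (v : ℝ × ℝ) :
    ∫ p in Set.Ioi (0 : ℝ) ×ˢ (Set.univ : Set (ℝ × ℝ)), fderiv ℝ F p (0, v) = 0 := by
  have hd : Continuous fun p => fderiv ℝ F p (0, v) :=
    (hF.continuous_fderiv one_ne_zero).clm_apply continuous_const
  have hdc : HasCompactSupport fun p => fderiv ℝ F p (0, v) :=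
    (hc.fderiv (𝕜 := ℝ)).comp_left (g := fun L : ℝ × ℝ × ℝ →L[ℝ] ℂ => L (0, v)) (by simp)
  rw [Measure.volume_eq_prod, setIntegral_prod _ (hd.integrable_of_hasCompactSupport
    (μ := (volume : Measure ℝ).prod (volume : Measure (ℝ × ℝ))) hdc).integrableOn,
    Measure.restrict_univ]
  refine (integral_congr_ae (.of_forall fun t => ?_)).trans
    (integral_zero ℝ ℂ)
  have hs : ContDiff ℝ 1 fun q : ℝ × ℝ => F (t, q) := hF.comp (contDiff_const.prodMk contDiff_id)
  have h0 := integral_fderiv_apply_eq_zero hs (hasCompactSupport_comp_prodMk_left hc t) v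
  rw [← h0]
  congr 1; ext q
  have h1 : HasFDerivAt (fun q : ℝ × ℝ => F (t, q)) _ q :=
    (hF.differentiable one_ne_zero (t, q)).hasFDerivAt.comp q
      ((hasFDerivAt_const t q).prodMk (hasFDerivAt_id q))
  rw [h1.fderiv]
  simp

theorem integral_halfSpace_divergence {f₀ f₁ f₂ : ℝ × ℝ × ℝ → ℂ} (h₀ : ContDiff ℝ 1 f₀)
    (h₁ : ContDiff ℝ 1 f₁) (h₂ : ContDiff ℝ 1 f₂) (c₀ : HasCompactSupport f₀)
    (c₁ : HasCompactSupport f₁) (c₂ : HasCompactSupport f₂) :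
    ∫ p in Set.Ioi (0 : ℝ) ×ˢ (Set.univ : Set (ℝ × ℝ)), (fderiv ℝ f₀ p (1, 0, 0) +
      fderiv ℝ f₁ p (0, 1, 0) + fderiv ℝ f₂ p (0, 0, 1)) = -∫ q : ℝ × ℝ, f₀ (0, q) := by
  have hi {F : ℝ × ℝ × ℝ → ℂ} (hF : ContDiff ℝ 1 F) (hc : HasCompactSupport F)
      (v : ℝ × ℝ × ℝ) : IntegrableOn (fun p => fderiv ℝ F p v)
        (Set.Ioi (0 : ℝ) ×ˢ (Set.univ : Set (ℝ × ℝ))) :=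
    (((hF.continuous_fderiv one_ne_zero).clm_apply
      continuous_const).integrable_of_hasCompactSupport ((hc.fderiv (𝕜 := ℝ)).comp_left
        (g := fun L : ℝ × ℝ × ℝ →L[ℝ] ℂ => L v) (by simp))).integrableOn
  rw [integral_add (f := fun p => fderiv ℝ f₀ p (1, 0, 0) + fderiv ℝ f₁ p (0, 1, 0))
      ((hi h₀ c₀ _).add (hi h₁ c₁ _)) (hi h₂ c₂ _), integral_add (hi h₀ c₀ _) (hi h₁ c₁ _), integral_halfSpace_fderiv_time h₀ c₀,
    integral_halfSpace_fderiv_space h₁ c₁, integral_halfSpace_fderiv_space h₂ c₂]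
  simp

/-- The pairing of a vector with the adjoint mode `(1, κlρx, ilρx/κ)`, without its exponential. -/
noncomputable def modePairing (κ : ℂ) (l ρ x : ℝ) (w : Fin 3 → ℂ) : ℂ :=
  w 0 + κ * l * ρ * x * w 1 + I * κ⁻¹ * l * ρ * x * w 2

theorem opL_zero_apply (a : ℂ) (U : ℝ × ℝ × ℝ → Fin 3 → ℂ) (p : ℝ × ℝ × ℝ) :
    opL a U p 0 = fderiv ℝ U p (1, 0, 0) 0 + fderiv ℝ U p (0, 1, 0) 1 +
      p.2.1 * (a * fderiv ℝ U p (0, 0, 1) 1 + fderiv ℝ U p (0, 0, 1) 2) := by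
  simp only [opL, Pi.add_apply, Pi.smul_apply, Matrix.mulVec, dotProduct, Fin.sum_univ_three]
  simp [coeffA, coeffB]

theorem opL_one_apply (a : ℂ) (U : ℝ × ℝ × ℝ → Fin 3 → ℂ) (p : ℝ × ℝ × ℝ) :
    opL a U p 1 = fderiv ℝ U p (1, 0, 0) 1 + fderiv ℝ U p (0, 1, 0) 0 -
      p.2.1 * (a * fderiv ℝ U p (0, 0, 1) 0) := by
  simp only [opL, Pi.add_apply, Pi.smul_apply, Matrix.mulVec, dotProduct, Fin.sum_univ_three]
  simp [coeffA, coeffB]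
  ring

theorem opL_two_apply (a : ℂ) (U : ℝ × ℝ × ℝ → Fin 3 → ℂ) (p : ℝ × ℝ × ℝ) :
    opL a U p 2 = fderiv ℝ U p (1, 0, 0) 2 +
      p.2.1 * ((1 + a ^ 2) * fderiv ℝ U p (0, 0, 1) 0) := by
  simp only [opL, Pi.add_apply, Pi.smul_apply, Matrix.mulVec, dotProduct, Fin.sum_univ_three]
  simp [coeffA, coeffB]

/-- Duality with an adjoint mode: the fluxes of `U` paired with the mode have divergence
`L_a U` paired with the mode, because `κ² = -(1 - ia)` is the dispersion relation of the adjoint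
system. -/
theorem integral_halfSpace_opL_mode {a κ : ℂ} (hκ : κ ^ 2 = -(1 - I * a)) (hκ0 : κ ≠ 0)
    {U : ℝ × ℝ × ℝ → Fin 3 → ℂ} (hU : ContDiff ℝ 1 U) (hc : HasCompactSupport U) (l ρ y₀ : ℝ) :
    ∫ p in Set.Ioi (0 : ℝ) ×ˢ (Set.univ : Set (ℝ × ℝ)),
      cexp (modeExponent κ l p.1 p.2.1 (p.2.2 - y₀) ρ) * modePairing κ l ρ p.2.1 (opL a U p) =
      -∫ q : ℝ × ℝ, cexp (modeExponent κ l 0 q.1 (q.2 - y₀) ρ) *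
        modePairing κ l ρ q.1 (U (0, q)) := by
  set e : ℝ × ℝ × ℝ → ℂ := fun p => cexp (modeExponent κ l p.1 p.2.1 (p.2.2 - y₀) ρ) with he
  have hpr : ContDiff ℝ 1 fun p : ℝ × ℝ × ℝ => (p.1 : ℂ) := ofRealCLM.contDiff.comp contDiff_fst
  have hpx : ContDiff ℝ 1 fun p : ℝ × ℝ × ℝ => (p.2.1 : ℂ) :=
    ofRealCLM.contDiff.comp (contDiff_fst.comp contDiff_snd)
  have hpy : ContDiff ℝ 1 fun p : ℝ × ℝ × ℝ => ((p.2.2 - y₀ : ℝ) : ℂ) :=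
    ofRealCLM.contDiff.comp ((contDiff_snd.comp contDiff_snd).sub contDiff_const)
  have hec : ContDiff ℝ 1 e := by
    rw [he]; unfold modeExponent; fun_prop
  have hu (i : Fin 3) : ContDiff ℝ 1 fun p => U p i := contDiff_pi.1 hU i
  have hcu (i : Fin 3) : HasCompactSupport fun p => U p i :=
    hc.comp_left (g := fun w : Fin 3 → ℂ => w i) rfl
  have hcomb (b c d : ℝ × ℝ × ℝ → ℂ) : HasCompactSupport fun p =>
      e p * (b p * U p 0 + c p * U p 1 + d p * U p 2) :=
    (((hcu 0).mul_left.add (hcu 1).mul_left).add (hcu 2).mul_left).mul_left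
  have hf₀ : ContDiff ℝ 1 fun p => e p * (1 * U p 0 + κ * l * ρ * p.2.1 * U p 1 +
      I * κ⁻¹ * l * ρ * p.2.1 * U p 2) := by fun_prop
  have hf₁ : ContDiff ℝ 1 fun p => e p * (κ * l * ρ * p.2.1 * U p 0 + 1 * U p 1 +
      0 * U p 2) := by fun_prop
  have hf₂ : ContDiff ℝ 1 fun p => e p * ((p.2.1 * (-(κ * l * ρ * p.2.1 * a) +
      I * κ⁻¹ * l * ρ * p.2.1 * (1 + a ^ 2))) * U p 0 + p.2.1 * a * U p 1 +
      p.2.1 * U p 2) := by fun_prop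
  have key := integral_halfSpace_divergence hf₀ hf₁ hf₂
    (hcomb _ (fun p => κ * l * ρ * p.2.1) (fun p => I * κ⁻¹ * l * ρ * p.2.1))
    (hcomb (fun p => κ * l * ρ * p.2.1) _ _)
    (hcomb (fun p => p.2.1 * (-(κ * l * ρ * p.2.1 * a) +
      I * κ⁻¹ * l * ρ * p.2.1 * (1 + a ^ 2))) (fun p => p.2.1 * a) (fun p => p.2.1))
  have hR : ∫ q : ℝ × ℝ, cexp (modeExponent κ l 0 q.1 (q.2 - y₀) ρ) *
        modePairing κ l ρ q.1 (U (0, q)) = ∫ q : ℝ × ℝ, e (0, q) * (1 * U (0, q) 0 +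
        κ * l * ρ * q.1 * U (0, q) 1 + I * κ⁻¹ * l * ρ * q.1 * U (0, q) 2) := by
    simp only [he, modePairing, one_mul]
  rw [hR, ← key]
  congr 1; ext p
  obtain ⟨t, x, y⟩ := p
  -- Directional derivatives are computed along the coordinate lines.
  have slice_t {F : ℝ × ℝ × ℝ → ℂ} (hF : ContDiff ℝ 1 F) :
      HasDerivAt (fun τ => F (τ, x, y)) (fderiv ℝ F (t, x, y) (1, 0, 0)) t :=
    (hF.differentiable one_ne_zero (t, x, y)).hasFDerivAt.comp_hasDerivAt t
      ((hasDerivAt_id t).prodMk (hasDerivAt_const t (x, y)))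
  have slice_x {F : ℝ × ℝ × ℝ → ℂ} (hF : ContDiff ℝ 1 F) :
      HasDerivAt (fun ξ => F (t, ξ, y)) (fderiv ℝ F (t, x, y) (0, 1, 0)) x :=
    (hF.differentiable one_ne_zero (t, x, y)).hasFDerivAt.comp_hasDerivAt x
      ((hasDerivAt_const x t).prodMk ((hasDerivAt_id x).prodMk (hasDerivAt_const x y)))
  have slice_y {F : ℝ × ℝ × ℝ → ℂ} (hF : ContDiff ℝ 1 F) :
      HasDerivAt (fun η => F (t, x, η)) (fderiv ℝ F (t, x, y) (0, 0, 1)) y :=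
    (hF.differentiable one_ne_zero (t, x, y)).hasFDerivAt.comp_hasDerivAt y
      ((hasDerivAt_const y t).prodMk ((hasDerivAt_const y x).prodMk (hasDerivAt_id y)))
  have hcomp (i : Fin 3) (v : ℝ × ℝ × ℝ) :
      fderiv ℝ (fun p => U p i) (t, x, y) v = fderiv ℝ U (t, x, y) v i := by
    have := (hasFDerivAt_pi'.1 (hU.differentiable one_ne_zero (t, x, y)).hasFDerivAt i).fderiv
    rw [this]; rfl
  have ofR (z : ℝ) : HasDerivAt (fun r : ℝ => (r : ℂ)) 1 z := ofRealCLM.hasDerivAt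
  have et : HasDerivAt (fun τ => e (τ, x, y)) (e (t, x, y) * -(κ * l * ρ)) t := by
    refine HasDerivAt.cexp ?_
    unfold modeExponent
    simpa using ((ofR t).const_mul (κ * l * ρ)).const_sub
      (I * l ^ 2 * ρ ^ 2 * ((y - y₀ : ℝ) : ℂ) - l ^ 2 * ρ ^ 2 * x ^ 2 / 2)
  have ex : HasDerivAt (fun ξ => e (t, ξ, y)) (e (t, x, y) * -(l ^ 2 * ρ ^ 2 * x)) x := by
    refine HasDerivAt.cexp ?_
    unfold modeExponent
    have := ((((ofR x).pow 2).const_mul ((l : ℂ) ^ 2 * ρ ^ 2)).div_const 2).const_sub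
      (I * l ^ 2 * ρ ^ 2 * ((y - y₀ : ℝ) : ℂ)) |>.sub_const (κ * l * ρ * t)
    convert! this using 1
    simp
    ring
  have ey : HasDerivAt (fun η => e (t, x, η)) (e (t, x, y) * (I * l ^ 2 * ρ ^ 2)) y := by
    refine HasDerivAt.cexp ?_
    unfold modeExponent
    have h1 : HasDerivAt (fun η : ℝ => ((η - y₀ : ℝ) : ℂ)) 1 y := by
      simpa using (ofR y).sub_const (y₀ : ℂ)
    simpa using ((h1.const_mul (I * l ^ 2 * ρ ^ 2)).sub_const
      ((l : ℂ) ^ 2 * ρ ^ 2 * x ^ 2 / 2)).sub_const (κ * l * ρ * t)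
  have d₀ := (slice_t hf₀).unique (et.mul ((((slice_t (hu 0)).const_mul 1).add
    ((slice_t (hu 1)).const_mul (κ * l * ρ * x))).add
      ((slice_t (hu 2)).const_mul (I * κ⁻¹ * l * ρ * x))))
  have d₁ := (slice_x hf₁).unique (ex.mul (((((ofR x).const_mul (κ * l * ρ)).mul
    (slice_x (hu 0))).add ((slice_x (hu 1)).const_mul 1)).add ((slice_x (hu 2)).const_mul 0)))
  have d₂ := (slice_y hf₂).unique (ey.mul ((((slice_y (hu 0)).const_mul
    ((x : ℂ) * (-(κ * l * ρ * x * a) + I * κ⁻¹ * l * ρ * x * (1 + a ^ 2)))).add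
      ((slice_y (hu 1)).const_mul ((x : ℂ) * a))).add ((slice_y (hu 2)).const_mul (x : ℂ))))
  rw [d₀, d₁, d₂]
  simp only [modePairing, opL_zero_apply, opL_one_apply, opL_two_apply, hcomp]
  have e1 : cexp (modeExponent κ l t x (y - y₀) ρ) = e (t, x, y) := rfl
  rw [e1]
  have hκκ : κ * κ⁻¹ = 1 := mul_inv_cancel₀ hκ0
  linear_combination e (t, x, y) * (l ^ 3 * ρ ^ 3 * x ^ 2 * U (t, x, y) 0 *
    (-(κ * (1 + I * a)) * hκκ + κ⁻¹ * (1 + I * a) * hκ - κ⁻¹ * I_sq) +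
    l ^ 2 * ρ ^ 2 * x * U (t, x, y) 1 * hκ + I * l ^ 2 * ρ ^ 2 * x * U (t, x, y) 2 * hκκ)

/-! ### Localization of a solution -/

theorem opL_congr {a : ℂ} {U V : ℝ × ℝ × ℝ → Fin 3 → ℂ} {p : ℝ × ℝ × ℝ} (h : U =ᶠ[nhds p] V) :
    opL a U p = opL a V p := by
  simp only [opL, h.fderiv_eq]

theorem opL_eq_zero_of_notMem_tsupport {a : ℂ} {U : ℝ × ℝ × ℝ → Fin 3 → ℂ} {p : ℝ × ℝ × ℝ}
    (h : p ∉ tsupport U) : opL a U p = 0 := by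
  rw [opL_congr (notMem_tsupport_iff_eventuallyEq.1 h)]
  simp [opL]

theorem continuous_opL {a : ℂ} {U : ℝ × ℝ × ℝ → Fin 3 → ℂ} (hU : ContDiff ℝ 1 U) :
    Continuous (opL a U) := by
  have h (v : ℝ × ℝ × ℝ) : Continuous fun p => fderiv ℝ U p v :=
    (hU.continuous_fderiv one_ne_zero).clm_apply continuous_const
  have hx : Continuous fun p : ℝ × ℝ × ℝ => (p.2.1 : ℂ) := by fun_prop
  exact ((h _).add (continuous_const.matrix_mulVec (h _))).add
    (hx.smul (continuous_const.matrix_mulVec (h _)))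

/-- A set of reals has a smooth cutoff function which is one near its `2d`-neighbourhood and is
supported in its `3d`-neighbourhood. -/
theorem exists_contDiff_cutoff (S : Set ℝ) {d : ℝ} (hd : 0 < d) :
    ∃ θ : ℝ → ℝ, ContDiff ℝ ∞ θ ∧ (∀ y ∈ Metric.cthickening (2 * d) S, ∀ᶠ z in nhds y, θ z = 1) ∧
      tsupport θ ⊆ Metric.cthickening (3 * d) S := by
  have hsub : Metric.cthickening (2 * d) S ⊆ interior (Metric.thickening (3 * d) S) := by
    rw [Metric.isOpen_thickening.interior_eq]
    exact Metric.cthickening_subset_thickening' (by linarith) (by linarith) S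
  obtain ⟨f, hf1, hf0, -⟩ := exists_contMDiffMap_one_nhds_of_subset_interior
    (n := (⊤ : ℕ∞)) (I := modelWithCornersSelf ℝ ℝ) (M := ℝ) Metric.isClosed_cthickening hsub
  refine ⟨f, f.contMDiff.contDiff, fun y hy => ?_, ?_⟩
  · exact hf1.filter_mono (nhds_le_nhdsSet hy)
  · refine closure_minimal (fun y hy => ?_) Metric.isClosed_cthickening
    by_contra hcon
    exact hy (hf0 y fun h => hcon (Metric.thickening_subset_cthickening _ _ h))

/-- Cutting off a solution near `{0} × {0} × supp ψ` gives a compactly supported function with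
the initial values `χ(x) φ(x) ψ(y) W₀`, whose image under `L_a` lives, for `t ≥ 0`, at positive
times, away from `x = 0`, or away from a neighbourhood of `supp ψ`. -/
theorem IsC1Solution.exists_localization {a : ℂ} {φ ψ : ℝ → ℝ} {Ω : Set (ℝ × ℝ × ℝ)}
    {U : ℝ × ℝ × ℝ → Fin 3 → ℂ} (hU : IsC1Solution a φ ψ Ω U) (hψ : HasCompactSupport ψ)
    (hφ₀ : φ 0 ≠ 0) (hΩ : IsOpen Ω)
    (hsupp : ∀ q ∈ tsupport (fun q : ℝ × ℝ => φ q.1 * ψ q.2), ((0 : ℝ), q.1, q.2) ∈ Ω) :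
    ∃ (V : ℝ × ℝ × ℝ → Fin 3 → ℂ) (χ : ℝ → ℝ) (T r d : ℝ), 0 < r ∧ 0 < d ∧
      ContDiff ℝ 1 V ∧ HasCompactSupport V ∧ Continuous χ ∧ HasCompactSupport χ ∧ χ 0 = 1 ∧
      (∀ x y : ℝ, V (0, x, y) = ((χ x * φ x * ψ y : ℝ) : ℂ) • vecW0) ∧
      ∀ p : ℝ × ℝ × ℝ, 0 ≤ p.1 → opL a V p ≠ 0 → p.1 ≤ T ∧ (r ≤ p.1 ∨ r ≤ |p.2.1| ∨
        ∀ y₀ ∈ Metric.cthickening d (tsupport ψ), d ≤ |p.2.2 - y₀|) := by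
  set S := tsupport ψ with hS
  have hSc : IsCompact S := hψ
  have hK0 : ({0} : Set ℝ) ×ˢ ({0} : Set ℝ) ×ˢ S ⊆ Ω := by
    rintro ⟨t, x, y⟩ ⟨ht, hx, hy⟩
    simp only [Set.mem_singleton_iff] at ht hx hy
    subst ht hx
    refine hsupp (0, y) ?_
    have hcont : Continuous fun y : ℝ => ((0 : ℝ), y) := by fun_prop
    have : Set.MapsTo (fun y : ℝ => ((0 : ℝ), y)) (Function.support ψ)
        (Function.support fun q : ℝ × ℝ => φ q.1 * ψ q.2) :=
      fun z hz => mul_ne_zero hφ₀ hz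
    exact map_mem_closure hcont hy this
  obtain ⟨r, hr, hrΩ⟩ := (isCompact_singleton.prod
    (isCompact_singleton.prod hSc)).exists_cthickening_subset_open hΩ hK0
  -- The cutoff in `y` is one on the `2d`-neighbourhood of `supp ψ` and lives in the
  -- `3d`-neighbourhood, which `d = r / 4` keeps within `Ω`.
  set d := r / 4 with hd
  have hd0 : 0 < d := by positivity
  have hbox : Metric.closedBall (0 : ℝ) r ×ˢ Metric.closedBall (0 : ℝ) r ×ˢ
      Metric.cthickening (3 * d) S ⊆ Ω := by
    rintro ⟨t, x, y⟩ ⟨ht, hx, hy⟩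
    apply hrΩ
    rw [hSc.cthickening_eq_biUnion_closedBall (by positivity)] at hy
    simp only [Set.mem_iUnion, exists_prop] at hy
    obtain ⟨z, hz, hyz⟩ := hy
    refine Metric.mem_cthickening_of_dist_le (t, x, y) (0, 0, z) r _ ⟨rfl, rfl, hz⟩ ?_
    simp only [Prod.dist_eq]
    refine max_le ht (max_le hx ?_)
    rw [Metric.mem_closedBall] at hyz
    linarith
  obtain ⟨θ, hθ, hθ1, hθS⟩ := exists_contDiff_cutoff S hd0
  let b : ContDiffBump (0 : ℝ) := ⟨r / 2, r, by positivity, by linarith⟩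
  have hb0 : b 0 = 1 := b.one_of_mem_closedBall (by simp [b.rIn_pos.le])
  set Λ : ℝ × ℝ × ℝ → ℝ := fun p => b p.1 * (b p.2.1 * θ p.2.2) with hΛ
  have hΛc : ContDiff ℝ 1 Λ := by
    have h1 : ContDiff ℝ 1 b := b.contDiff
    have h2 : ContDiff ℝ 1 θ := hθ.of_le (by exact_mod_cast le_top)
    exact (h1.comp contDiff_fst).mul ((h1.comp (contDiff_fst.comp contDiff_snd)).mul
      (h2.comp (contDiff_snd.comp contDiff_snd)))
  have hΛsupp : tsupport Λ ⊆ Metric.closedBall (0 : ℝ) r ×ˢ Metric.closedBall (0 : ℝ) r ×ˢ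
      Metric.cthickening (3 * d) S := by
    refine closure_minimal ?_ (Metric.isClosed_closedBall.prod
      (Metric.isClosed_closedBall.prod Metric.isClosed_cthickening))
    rintro ⟨t, x, y⟩ hp
    have hp' : b t * (b x * θ y) ≠ 0 := hp
    have h1 : b t ≠ 0 := left_ne_zero_of_mul hp'
    have h2 : b x ≠ 0 := left_ne_zero_of_mul (right_ne_zero_of_mul hp')
    have h3 : θ y ≠ 0 := right_ne_zero_of_mul (right_ne_zero_of_mul hp')
    have hball {z : ℝ} (hz : b z ≠ 0) : z ∈ Metric.closedBall (0 : ℝ) r :=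
      b.tsupport_eq ▸ subset_tsupport _ hz
    exact ⟨hball h1, hball h2, hθS (subset_tsupport _ h3)⟩
  have hΛΩ : tsupport Λ ⊆ Ω := hΛsupp.trans hbox
  have hΛcs : HasCompactSupport Λ := by
    refine IsCompact.of_isClosed_subset ?_ (isClosed_tsupport _) hΛsupp
    exact (isCompact_closedBall _ _).prod ((isCompact_closedBall _ _).prod hSc.cthickening)
  set V : ℝ × ℝ × ℝ → Fin 3 → ℂ := fun p => Λ p • U p with hV
  have hVΛ : tsupport V ⊆ tsupport Λ := tsupport_smul_subset_left Λ U
  refine ⟨V, b, r, r / 2, d, by positivity, hd0, ?_, ?_, b.continuous, b.hasCompactSupport, hb0,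
    fun x y => ?_, fun p hp0 hp => ?_⟩
  · rw [contDiff_iff_contDiffAt]
    intro p
    by_cases hp : p ∈ Ω
    · exact hΛc.contDiffAt.smul (hU.contDiffOn.contDiffAt (hΩ.mem_nhds hp))
    · have : V =ᶠ[nhds p] 0 :=
        notMem_tsupport_iff_eventuallyEq.1 fun h => hp (hΛΩ (hVΛ h))
      exact contDiffAt_const.congr_of_eventuallyEq this
  · exact hΛcs.smul_right
  · have hθψ : θ y * ψ y = ψ y := by
      by_cases hy : ψ y = 0
      · simp [hy]
      · have : y ∈ Metric.cthickening (2 * d) S :=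
          Metric.self_subset_cthickening S (subset_tsupport _ hy)
        rw [(hθ1 y this).self_of_nhds, one_mul]
    by_cases hp : ((0 : ℝ), x, y) ∈ Ω
    · simp only [hV, hΛ, hb0]
      rw [hU.initial x y hp, ← coe_smul, smul_smul, ← ofReal_mul]
      congr 2
      linear_combination b x * φ x * hθψ
    · have h0 : Λ (0, x, y) = 0 := image_eq_zero_of_notMem_tsupport fun h => hp (hΛΩ h)
      have h1 : b x * φ x * ψ y = 0 := by
        have : b x * θ y = 0 := by simpa [hΛ, hb0] using h0
        rw [← hθψ]
        linear_combination φ x * ψ y * this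
      simp only [hV]
      rw [h0, h1]
      simp
  · obtain ⟨t, x, y⟩ := p
    have hmem : (t, x, y) ∈ tsupport Λ := by
      by_contra hcon
      exact hp (opL_eq_zero_of_notMem_tsupport fun h => hcon (hVΛ h))
    refine ⟨?_, ?_⟩
    · have := (hΛsupp hmem).1
      simp only [Metric.mem_closedBall, dist_zero_right, Real.norm_eq_abs] at this
      exact (le_abs_self t).trans this
    · by_contra! hcon
      obtain ⟨ht, hx, y₀, hy₀, hy⟩ := hcon
      refine hp ?_
      have hyd : y ∈ Metric.cthickening (2 * d) S := by
        have h1 : y ∈ Metric.cthickening d (Metric.cthickening d S) :=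
          Metric.mem_cthickening_of_dist_le y y₀ d _ hy₀ (by rw [Real.dist_eq]; exact hy.le)
        have h2 := Metric.cthickening_cthickening_subset hd0.le hd0.le S h1
        rwa [← two_mul] at h2
      have ht' : ∀ᶠ z in nhds t, b z = 1 := by
        filter_upwards [Metric.isOpen_ball.mem_nhds (show t ∈ Metric.ball (0 : ℝ) (r / 2) by
          simp only [Metric.mem_ball, dist_zero_right, Real.norm_eq_abs]
          rwa [abs_of_nonneg hp0])] with z hz
        exact b.one_of_mem_closedBall (Metric.ball_subset_closedBall hz)
      have hx' : ∀ᶠ z in nhds x, b z = 1 := by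
        filter_upwards [Metric.isOpen_ball.mem_nhds (show x ∈ Metric.ball (0 : ℝ) (r / 2) by
          simpa only [Metric.mem_ball, dist_zero_right, Real.norm_eq_abs] using hx)] with z hz
        exact b.one_of_mem_closedBall (Metric.ball_subset_closedBall hz)
      have heq : V =ᶠ[nhds (t, x, y)] U := by
        rw [nhds_prod_eq, nhds_prod_eq]
        filter_upwards [ht'.prod_mk (hx'.prod_mk (hθ1 y hyd))] with z hz
        simp only [hV, hΛ]
        rw [hz.1, hz.2.1, hz.2.2]
        simp
      rw [opL_congr heq]
      exact hU.equation _ (hΛΩ hmem)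

/-! ### Decay of the wave packets of the initial values -/

theorem continuous_modePairing_opL {a κ : ℂ} {V : ℝ × ℝ × ℝ → Fin 3 → ℂ} (hV : ContDiff ℝ 1 V)
    (l : ℝ) : Continuous fun z : ℝ × (ℝ × ℝ × ℝ) =>
      modePairing κ l z.1 z.2.2.1 (opL a V z.2) := by
  have h (i : Fin 3) : Continuous fun z : ℝ × (ℝ × ℝ × ℝ) => opL a V z.2 i :=
    (continuous_apply i).comp ((continuous_opL hV).comp continuous_snd)
  have h0 := h 0
  have h1 := h 1
  have h2 := h 2
  unfold modePairing
  fun_prop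

theorem integral_mode_initial (κ : ℂ) (l ρ y₀ : ℝ) (h ψ : ℝ → ℝ) {V : ℝ × ℝ × ℝ → Fin 3 → ℂ}
    (hV : ∀ x y : ℝ, V (0, x, y) = ((h x * ψ y : ℝ) : ℂ) • vecW0) :
    ∫ q : ℝ × ℝ, cexp (modeExponent κ l 0 q.1 (q.2 - y₀) ρ) * modePairing κ l ρ q.1 (V (0, q)) =
      gaussianMoment h l ρ * ∫ y : ℝ, (ψ y : ℂ) * cexp (I * l ^ 2 * ρ ^ 2 * (y - y₀)) := by
  rw [gaussianMoment, ← integral_prod_mul, ← Measure.volume_eq_prod]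
  congr 1; ext q
  obtain ⟨x, y⟩ := q
  rw [hV]
  have e : modeExponent κ l 0 x (y - y₀) ρ =
      -(l ^ 2 * ρ ^ 2 * x ^ 2 / 2) + I * l ^ 2 * ρ ^ 2 * (y - y₀) := by
    rw [modeExponent]; push_cast; ring
  rw [e, Complex.exp_add]
  simp only [modePairing, vecW0, Pi.smul_apply, Matrix.cons_val_zero, Matrix.cons_val_one,
    Matrix.cons_val, smul_eq_mul, mul_one, mul_zero, add_zero]
  push_cast
  ring

/-- The wave packet integral of `ψ` is the superposition over `ρ` of the duality identities with
the adjoint modes, each divided by the Gaussian moment of the profile in `x`. -/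
theorem wavePacket_eq_integral_halfSpace {a κ : ℂ} (hκ : κ ^ 2 = -(1 - I * a)) (hκ0 : κ ≠ 0)
    {V : ℝ × ℝ × ℝ → Fin 3 → ℂ} (hV : ContDiff ℝ 1 V) (hVc : HasCompactSupport V)
    {h ψ : ℝ → ℝ} (hh : Continuous h) (hhc : HasCompactSupport h)
    (hV0 : ∀ x y : ℝ, V (0, x, y) = ((h x * ψ y : ℝ) : ℂ) • vecW0) {l : ℝ} (hl : l ≠ 0)
    (hΦ : ∀ ρ ∈ contourRect, (l : ℂ) * gaussianMoment h l ρ ≠ 0) (y₀ : ℝ) :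
    (∫ ρ in (1 / 2 : ℝ)..(3 / 2), (ρ : ℂ) * cexp (-(l ^ 2 * (ρ ^ 2 - 1) ^ 2 / 2)) *
      ∫ y : ℝ, (ψ y : ℂ) * cexp (I * l ^ 2 * ρ ^ 2 * (y - y₀))) =
    -((l : ℂ) * ∫ p in Set.Ioi (0 : ℝ) ×ˢ (Set.univ : Set (ℝ × ℝ)),
      ∫ ρ in (1 / 2 : ℝ)..(3 / 2), (ρ : ℂ) / (l * gaussianMoment h l ρ) *
        (cexp (-(l ^ 2 * ((ρ : ℂ) ^ 2 - 1) ^ 2 / 2)) *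
          cexp (modeExponent κ l p.1 p.2.1 (p.2.2 - y₀) ρ)) *
            modePairing κ l ρ p.2.1 (opL a V p)) := by
  set k : ℝ → ℂ := fun ρ => (ρ : ℂ) / (l * gaussianMoment h l ρ) *
    cexp (-(l ^ 2 * ((ρ : ℂ) ^ 2 - 1) ^ 2 / 2)) with hk
  set H : ℝ → ℝ × ℝ × ℝ → ℂ := fun ρ p => cexp (modeExponent κ l p.1 p.2.1 (p.2.2 - y₀) ρ) *
    modePairing κ l ρ p.2.1 (opL a V p) with hH
  have hlC : (l : ℂ) ≠ 0 := by exact_mod_cast hl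
  have hkc : ContinuousOn k (Set.Icc (1 / 2) (3 / 2)) := by
    have h1 : Continuous fun ρ : ℝ => (l : ℂ) * gaussianMoment h l ρ :=
      continuous_const.mul ((differentiable_gaussianMoment hh hhc l).continuous.comp
        continuous_ofReal)
    refine (continuous_ofReal.continuousOn.div h1.continuousOn fun ρ hρ =>
      hΦ _ (ofReal_mem_contourRect hρ)).mul (Continuous.continuousOn (by fun_prop))
  have hHc : Continuous (Function.uncurry H) := by
    refine Continuous.mul ?_ (continuous_modePairing_opL hV l)
    unfold modeExponent
    fun_prop
  have hint : Integrable (Function.uncurry fun ρ p => k ρ * H ρ p)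
      ((volume.restrict (Set.uIoc (1 / 2 : ℝ) (3 / 2))).prod
        (volume.restrict (Set.Ioi (0 : ℝ) ×ˢ (Set.univ : Set (ℝ × ℝ))))) := by
    rw [Measure.prod_restrict, Set.uIoc_of_le (by norm_num)]
    have hcomp : IntegrableOn (Function.uncurry fun ρ p => k ρ * H ρ p)
        (Set.Icc (1 / 2 : ℝ) (3 / 2) ×ˢ tsupport V)
        ((volume : Measure ℝ).prod (volume : Measure (ℝ × ℝ × ℝ))) := by
      refine ContinuousOn.integrableOn_compact (isCompact_Icc.prod hVc) ?_
      exact (hkc.comp continuousOn_fst fun z hz => hz.1).mul hHc.continuousOn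
    refine IntegrableOn.mono_set (t := Set.Icc (1 / 2 : ℝ) (3 / 2) ×ˢ Set.univ) ?_
      (Set.prod_mono Set.Ioc_subset_Icc_self (Set.subset_univ _))
    refine hcomp.of_forall_sdiff_eq_zero (measurableSet_Icc.prod MeasurableSet.univ) ?_
    rintro ⟨ρ, p⟩ ⟨hρ, hp⟩
    have hpV : p ∉ tsupport V := fun hcon => hp ⟨hρ.1, hcon⟩
    simp [Function.uncurry, hH, opL_eq_zero_of_notMem_tsupport hpV, modePairing]
  have hswap := intervalIntegral_integral_swap hint
  have hpt (ρ : ℝ) (hρ : ρ ∈ Set.uIcc (1 / 2 : ℝ) (3 / 2)) :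
      (ρ : ℂ) * cexp (-(l ^ 2 * (ρ ^ 2 - 1) ^ 2 / 2)) *
      (∫ y : ℝ, (ψ y : ℂ) * cexp (I * l ^ 2 * ρ ^ 2 * (y - y₀))) =
      -((l : ℂ) * ∫ p in Set.Ioi (0 : ℝ) ×ˢ (Set.univ : Set (ℝ × ℝ)), k ρ * H ρ p) := by
    rw [Set.uIcc_of_le (by norm_num)] at hρ
    have hne := hΦ _ (ofReal_mem_contourRect hρ)
    rw [integral_const_mul, hH, integral_halfSpace_opL_mode hκ hκ0 hV hVc,
      integral_mode_initial κ l ρ y₀ h ψ hV0, hk]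
    have hg : gaussianMoment h l ρ ≠ 0 := right_ne_zero_of_mul hne
    field_simp
  rw [intervalIntegral.integral_congr hpt, intervalIntegral.integral_neg,
    intervalIntegral.integral_const_mul, hswap]
  congr 4; ext p
  congr 1; ext ρ
  simp only [hk, hH]
  ring

/-- The pairing is affine in `ρ`, so two scalar superpositions control the superposition of the
paired modes. -/
theorem norm_integral_mode_mul_pairing_le {κ : ℂ} {l t x s B : ℝ} (hl : 1 ≤ l) {k : ℂ → ℂ}
    (hk : ContinuousOn k contourRect) (w : Fin 3 → ℂ)
    (h₀ : ‖∫ ρ in (1 / 2 : ℝ)..(3 / 2), k ρ * (cexp (-(l ^ 2 * ((ρ : ℂ) ^ 2 - 1) ^ 2 / 2)) *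
      cexp (modeExponent κ l t x s ρ))‖ ≤ B)
    (h₁ : ‖∫ ρ in (1 / 2 : ℝ)..(3 / 2), (k ρ * ρ) *
      (cexp (-(l ^ 2 * ((ρ : ℂ) ^ 2 - 1) ^ 2 / 2)) * cexp (modeExponent κ l t x s ρ))‖ ≤ B) :
    ‖∫ ρ in (1 / 2 : ℝ)..(3 / 2), k ρ * (cexp (-(l ^ 2 * ((ρ : ℂ) ^ 2 - 1) ^ 2 / 2)) *
      cexp (modeExponent κ l t x s ρ)) * modePairing κ l ρ x w‖ ≤
      l * B * (‖w 0‖ + |x| * (‖κ‖ * ‖w 1‖ + ‖κ⁻¹‖ * ‖w 2‖)) := by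
  set E : ℝ → ℂ := fun ρ => cexp (-(l ^ 2 * ((ρ : ℂ) ^ 2 - 1) ^ 2 / 2)) *
    cexp (modeExponent κ l t x s ρ) with hE
  have hEc : Continuous E := by
    have := (differentiable_modeExponent κ l t x s).continuous
    fun_prop
  have hkc : ContinuousOn (fun ρ : ℝ => k ρ) (Set.uIcc (1 / 2) (3 / 2)) := by
    rw [Set.uIcc_of_le (by norm_num)]
    exact hk.comp continuous_ofReal.continuousOn fun ρ hρ => ofReal_mem_contourRect hρ
  have i₀ : IntervalIntegrable (fun ρ : ℝ => k ρ * E ρ) volume (1 / 2) (3 / 2) :=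
    (hkc.mul hEc.continuousOn).intervalIntegrable
  have i₁ : IntervalIntegrable (fun ρ : ℝ => k ρ * ρ * E ρ) volume (1 / 2) (3 / 2) :=
    ((hkc.mul continuous_ofReal.continuousOn).mul hEc.continuousOn).intervalIntegrable
  have heq : (∫ ρ in (1 / 2 : ℝ)..(3 / 2), k ρ * E ρ * modePairing κ l ρ x w) =
      (∫ ρ in (1 / 2 : ℝ)..(3 / 2), k ρ * E ρ) * w 0 +
      (∫ ρ in (1 / 2 : ℝ)..(3 / 2), k ρ * ρ * E ρ) * (l * (x * (κ * w 1 + I * κ⁻¹ * w 2))) := by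
    rw [← intervalIntegral.integral_mul_const, ← intervalIntegral.integral_mul_const,
      ← intervalIntegral.integral_add (i₀.mul_const _) (i₁.mul_const _)]
    congr 1; ext ρ
    rw [modePairing]; ring
  have hB : 0 ≤ B := (norm_nonneg _).trans h₀
  rw [heq]
  refine (norm_add_le _ _).trans ?_
  rw [norm_mul, norm_mul, norm_mul, norm_mul, norm_real, norm_real, Real.norm_eq_abs,
    Real.norm_eq_abs, abs_of_pos (by linarith : 0 < l)]
  have h2 : ‖κ * w 1 + I * κ⁻¹ * w 2‖ ≤ ‖κ‖ * ‖w 1‖ + ‖κ⁻¹‖ * ‖w 2‖ := by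
    refine (norm_add_le _ _).trans (le_of_eq ?_)
    rw [norm_mul, norm_mul, norm_mul, norm_I, one_mul]
  calc _ ≤ B * ‖w 0‖ + B * (l * (|x| * (‖κ‖ * ‖w 1‖ + ‖κ⁻¹‖ * ‖w 2‖))) := by gcongr
    _ ≤ (l * B) * ‖w 0‖ + B * (l * (|x| * (‖κ‖ * ‖w 1‖ + ‖κ⁻¹‖ * ‖w 2‖))) := by
        gcongr; exact le_mul_of_one_le_left hB hl
    _ = _ := by ring

/-- When `κ² = -(1 - ia)` has a root with positive real part, existence of a solution forces
`ψ` into the Gevrey class of order two. -/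
theorem isGevrey_two_of_isC1Solution {a κ : ℂ} (hκ : κ ^ 2 = -(1 - I * a)) (hκre : 0 < κ.re)
    {φ ψ : ℝ → ℝ} (hφ : Continuous φ) (hψ : IsTestFunction ψ) (hφ₀ : φ 0 ≠ 0)
    {Ω : Set (ℝ × ℝ × ℝ)} (hΩ : IsOpen Ω)
    (hsupp : ∀ q ∈ tsupport (fun q : ℝ × ℝ => φ q.1 * ψ q.2), ((0 : ℝ), q.1, q.2) ∈ Ω)
    {U : ℝ × ℝ × ℝ → Fin 3 → ℂ} (hU : IsC1Solution a φ ψ Ω U) : IsGevrey 2 ψ := by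
  have hκ0 : κ ≠ 0 := by rintro rfl; simp at hκre
  obtain ⟨V, χ, T, r, d, hr, hd, hV, hVc, hχ, hχc, hχ0, hV0, hfar⟩ :=
    hU.exists_localization hψ.2 hφ₀ hΩ hsupp
  set h : ℝ → ℝ := fun x => χ x * φ x with hh
  have hhc : Continuous h := hχ.mul hφ
  have hhs : HasCompactSupport h := hχc.mul_right
  obtain ⟨c₀, R, hc₀, hΦ⟩ := exists_le_norm_gaussianMoment hhc hhs (by simpa [hh, hχ0] using hφ₀)
  obtain ⟨C, c, hc, hpacket⟩ := exists_norm_packet_le hκre (T := T) hr hr hd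
  set S := Set.Ioi (0 : ℝ) ×ˢ (Set.univ : Set (ℝ × ℝ)) with hS
  have hSm : MeasurableSet S := measurableSet_Ioi.prod MeasurableSet.univ
  set N : ℝ × ℝ × ℝ → ℝ := fun p => ‖opL a V p 0‖ +
    |p.2.1| * (‖κ‖ * ‖opL a V p 1‖ + ‖κ⁻¹‖ * ‖opL a V p 2‖) with hN
  have hNi : Integrable N := by
    have hc (i : Fin 3) : Continuous fun p => ‖opL a V p i‖ :=
      ((continuous_apply i).comp (continuous_opL hV)).norm
    have h0 := hc 0
    have h1 := hc 1
    have h2 := hc 2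
    refine Continuous.integrable_of_hasCompactSupport (by fun_prop) ?_
    refine HasCompactSupport.intro hVc fun p hp => ?_
    simp [hN, opL_eq_zero_of_notMem_tsupport hp]
  set M := 4 / c₀ with hM
  have hM0 : 0 < M := by positivity
  set J := ∫ p in S, N p with hJ
  -- The bound on the superposition of modes, for base points near the support of `ψ`.
  have hB (l : ℝ) (hl : max 1 R ≤ l) (y₀ : ℝ)
      (hy₀ : y₀ ∈ Metric.cthickening d (tsupport ψ)) :
      ‖∫ ρ in (1 / 2 : ℝ)..(3 / 2), (ρ : ℂ) * cexp (-(l ^ 2 * (ρ ^ 2 - 1) ^ 2 / 2)) *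
        ∫ y : ℝ, (ψ y : ℂ) * cexp (I * l ^ 2 * ρ ^ 2 * (y - y₀))‖ ≤
        l * (l * (M * C * Real.exp (-(c * l))) * J) := by
    have hl1 : 1 ≤ l := (le_max_left _ _).trans hl
    have hl0 : 0 < l := by linarith
    have hΦl := hΦ l ((le_max_right _ _).trans hl)
    have hΦne (ρ : ℂ) (hρ : ρ ∈ contourRect) : (l : ℂ) * gaussianMoment h l ρ ≠ 0 :=
      norm_pos_iff.1 (hc₀.trans_le (hΦl ρ hρ))
    -- Dividing by the Gaussian moment keeps the amplitude holomorphic and bounded uniformly in `l`.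
    set k : ℂ → ℂ := fun ρ => ρ / (l * gaussianMoment h l ρ) with hk
    have hkd : DifferentiableOn ℂ k contourRect :=
      differentiableOn_id.div ((differentiable_gaussianMoment hhc hhs l).const_mul
        (l : ℂ)).differentiableOn hΦne
    have hkM (ρ : ℂ) (hρ : ρ ∈ contourRect) : ‖k ρ‖ ≤ M / 2 := by
      rw [hk, hM]; simp only
      rw [norm_div, show 4 / c₀ / 2 = 2 / c₀ by ring]
      exact div_le_div₀ zero_le_two (norm_le_two_of_mem_contourRect hρ) hc₀ (hΦl ρ hρ)
    have hkM₀ (ρ : ℂ) (hρ : ρ ∈ contourRect) : ‖k ρ‖ ≤ M := (hkM ρ hρ).trans (by linarith)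
    have hkM₁ (ρ : ℂ) (hρ : ρ ∈ contourRect) : ‖k ρ * ρ‖ ≤ M := by
      rw [norm_mul]
      calc _ ≤ M / 2 * 2 := by
            gcongr
            · exact hkM ρ hρ
            · exact norm_le_two_of_mem_contourRect hρ
        _ = M := by ring
    rw [wavePacket_eq_integral_halfSpace hκ hκ0 hV hVc hhc hhs hV0 hl0.ne' hΦne, norm_neg,
      norm_mul, norm_real, Real.norm_of_nonneg hl0.le]
    refine mul_le_mul_of_nonneg_left ?_ hl0.le
    rw [hJ, ← integral_const_mul]
    refine norm_integral_le_of_norm_le (hNi.const_mul _).integrableOn ?_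
    refine (ae_restrict_iff' hSm).2 (.of_forall fun p hp => ?_)
    have hp0 : 0 ≤ p.1 := le_of_lt hp.1
    by_cases hG : opL a V p = 0
    · simp [hG, modePairing, hN]
    obtain ⟨hpT, hpfar⟩ := hfar p hp0 hG
    have hpfar' : r ≤ p.1 ∨ r ≤ |p.2.1| ∨ d ≤ |p.2.2 - y₀| :=
      hpfar.imp_right fun h => h.imp_right fun h => h y₀ hy₀
    exact norm_integral_mode_mul_pairing_le hl1 hkd.continuousOn (opL a V p)
      (hpacket k M l _ _ _ hkd hkM₀ hl1 hp0 hpT hpfar')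
      (hpacket (fun ρ => k ρ * ρ) M l _ _ _ (hkd.mul differentiableOn_id) hkM₁ hl1 hp0 hpT hpfar')
  set Q := ∫ y : ℝ, ‖ψ y‖ with hQ
  set c₁ := min c (1 / 8) with hc₁
  have hc₁0 : 0 < c₁ := by positivity
  set D := |M * C * J| + |Q * √(4 * Real.pi)| with hD
  have hD0 : 0 ≤ D := by positivity
  obtain ⟨C', c', R', hc', hdecay⟩ := fourier_decay_of_gaussian_transform_decay
    (C := D * (Nat.factorial 3 * (2 / c₁) ^ 3)) (c := c₁ / 2) (R := max 1 R)
    hψ.1.continuous hψ.2 hd (half_pos hc₁0) fun l hl y₀ hy₀ => by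
      have hl1 : 1 ≤ l := (le_max_left _ _).trans hl
      have hl0 : 0 < l := by linarith
      refine (norm_gaussian_transform_le hψ.1.continuous hψ.2 hl1 y₀ (hB l hl y₀ hy₀)).trans ?_
      have e1 : Real.exp (-(c * l)) ≤ Real.exp (-(c₁ * l)) := by
        apply Real.exp_le_exp.2
        have := mul_le_mul_of_nonneg_right (min_le_left c (1 / 8)) hl0.le
        linarith
      have e2 : Real.exp (-(l / 8)) ≤ Real.exp (-(c₁ * l)) := by
        apply Real.exp_le_exp.2
        have := mul_le_mul_of_nonneg_right (min_le_right c (1 / 8)) hl0.le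
        linarith
      have hl3 : l ≤ l ^ 3 := le_self_pow₀ hl1 (by norm_num)
      calc l * (l * (l * (M * C * Real.exp (-(c * l))) * J) +
            Q * (√(4 * Real.pi) * Real.exp (-(l / 8))))
          = l ^ 3 * ((M * C * J) * Real.exp (-(c * l))) +
            l * ((Q * √(4 * Real.pi)) * Real.exp (-(l / 8))) := by ring
        _ ≤ l ^ 3 * (|M * C * J| * Real.exp (-(c₁ * l))) +
            l ^ 3 * (|Q * √(4 * Real.pi)| * Real.exp (-(c₁ * l))) := by
          gcongr
          · exact le_abs_self _
          · exact le_abs_self _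
        _ = D * (l ^ 3 * Real.exp (-(c₁ * l))) := by rw [hD]; ring
        _ ≤ D * (Nat.factorial 3 * (2 / c₁) ^ 3 * Real.exp (-(c₁ / 2 * l))) :=
          mul_le_mul_of_nonneg_left (pow_mul_exp_neg_le hc₁0 hl0.le 3) hD0
        _ = _ := by ring
  exact isGevrey_two_of_fourier_decay hψ hc' hdecay

/-! ### Complex conjugation and the choice of a growing mode -/

/-- Componentwise complex conjugation of `ℂ³`, as a real linear map. -/
noncomputable def conjVec : (Fin 3 → ℂ) →L[ℝ] (Fin 3 → ℂ) :=
  ContinuousLinearMap.pi fun i => (conjCLE : ℂ →L[ℝ] ℂ).comp (ContinuousLinearMap.proj i)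

theorem conjVec_apply (w : Fin 3 → ℂ) (i : Fin 3) : conjVec w i = starRingEnd ℂ (w i) := rfl

/-- The data being real, conjugation exchanges the problems for `a` and for its conjugate. -/
theorem IsC1Solution.conj {a : ℂ} {φ ψ : ℝ → ℝ} {Ω : Set (ℝ × ℝ × ℝ)}
    {U : ℝ × ℝ × ℝ → Fin 3 → ℂ} (hU : IsC1Solution a φ ψ Ω U) (hΩ : IsOpen Ω) :
    IsC1Solution (starRingEnd ℂ a) φ ψ Ω fun p => conjVec (U p) where
  contDiffOn := conjVec.contDiff.comp_contDiffOn hU.contDiffOn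
  equation p hp := by
    have hd : DifferentiableAt ℝ U p :=
      (hU.contDiffOn.contDiffAt (hΩ.mem_nhds hp)).differentiableAt one_ne_zero
    have hf (v : ℝ × ℝ × ℝ) :
        fderiv ℝ (fun p => conjVec (U p)) p v = conjVec (fderiv ℝ U p v) := by
      have h : HasFDerivAt (fun p => conjVec (U p)) _ p :=
        conjVec.hasFDerivAt.comp p hd.hasFDerivAt
      rw [h.fderiv]; rfl
    have h0 := congrArg (starRingEnd ℂ) (congrFun (hU.equation p hp) 0)
    have h1 := congrArg (starRingEnd ℂ) (congrFun (hU.equation p hp) 1)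
    have h2 := congrArg (starRingEnd ℂ) (congrFun (hU.equation p hp) 2)
    rw [opL_zero_apply] at h0
    rw [opL_one_apply] at h1
    rw [opL_two_apply] at h2
    simp only [map_add, map_sub, map_mul, map_pow, map_one, conj_ofReal, Pi.zero_apply,
      map_zero] at h0 h1 h2
    ext i
    fin_cases i
    · change opL _ _ p 0 = 0
      simpa only [opL_zero_apply, hf, conjVec_apply] using h0
    · change opL _ _ p 1 = 0
      simpa only [opL_one_apply, hf, conjVec_apply] using h1
    · change opL _ _ p 2 = 0
      simpa only [opL_two_apply, hf, conjVec_apply] using h2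
  initial x y hp := by
    ext i
    rw [conjVec_apply, hU.initial x y hp, Pi.smul_apply, smul_eq_mul, map_mul, conj_ofReal]
    congr 1
    fin_cases i <;> simp [vecW0]

theorem exists_sq_eq_re_pos {z : ℂ} (hz : ∀ r : ℝ, r ≤ 0 → z ≠ r) :
    ∃ κ : ℂ, κ ^ 2 = z ∧ 0 < κ.re := by
  obtain ⟨κ, hκ⟩ := IsAlgClosed.exists_pow_nat_eq z two_pos
  rcases lt_trichotomy κ.re 0 with h | h | h
  · exact ⟨-κ, by rw [neg_sq, hκ], by simpa using h⟩
  · refine absurd ?_ (hz (-κ.im ^ 2) (by nlinarith [sq_nonneg κ.im]))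
    rw [← hκ]
    conv_lhs => rw [← re_add_im κ, h]
    push_cast
    rw [zero_add, mul_pow, I_sq]
    ring
  · exact ⟨κ, hκ, h⟩

theorem mainTheorem3 (a : ℂ) (ha : ∀ r : ℝ, r ∈ Set.Icc (-1 : ℝ) 1 → Complex.I * a ≠ (r : ℂ))
    (φ ψ : ℝ → ℝ) (hφ : IsTestFunction φ) (hψ : IsTestFunction ψ)
    (hψ_even : ∀ y : ℝ, ψ (-y) = ψ y) (hψ_gevrey : ¬ IsGevreyCompact 2 ψ) (hφ_zero : φ 0 ≠ 0)
    (Ω : Set (ℝ × ℝ × ℝ)) (hΩ : IsOpen Ω) (hΩ_origin : ((0 : ℝ), (0 : ℝ), (0 : ℝ)) ∈ Ω)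
    (hsupp : ∀ q ∈ tsupport (fun q : ℝ × ℝ => φ q.1 * ψ q.2), ((0 : ℝ), q.1, q.2) ∈ Ω) :
    ¬ ∃ U : ℝ × ℝ × ℝ → Fin 3 → ℂ, IsC1Solution a φ ψ Ω U := by
  rintro ⟨U, hU⟩
  refine hψ_gevrey ⟨?_, hψ⟩
  by_cases hcase : ∃ s : ℝ, s < -1 ∧ I * a = s
  · -- Here the growing modes have negative frequency; conjugation makes the frequency positive.
    obtain ⟨s, hs, has⟩ := hcase
    have has' : I * starRingEnd ℂ a = ((-s : ℝ) : ℂ) := by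
      have := congrArg (starRingEnd ℂ) has
      rw [map_mul, conj_I, conj_ofReal] at this
      push_cast
      linear_combination -this
    obtain ⟨κ, hκ, hκre⟩ := exists_sq_eq_re_pos (z := -(1 - I * starRingEnd ℂ a))
      fun r hr heq => by
        rw [has'] at heq
        have : -(1 - -s) = r := by exact_mod_cast heq
        linarith
    exact isGevrey_two_of_isC1Solution hκ hκre hφ.1.continuous hψ hφ_zero hΩ hsupp (hU.conj hΩ)
  · obtain ⟨κ, hκ, hκre⟩ := exists_sq_eq_re_pos (z := -(1 - I * a)) fun r hr heq => by
      have h1 : I * a = ((1 + r : ℝ) : ℂ) := by push_cast; linear_combination heq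
      rcases lt_or_ge (1 + r) (-1) with h | h
      · exact hcase ⟨1 + r, h, h1⟩
      · exact ha (1 + r) ⟨h, by linarith⟩ h1
    exact isGevrey_two_of_isC1Solution hκ hκre hφ.1.continuous hψ hφ_zero hΩ hsupp hU
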